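/- There are $m$ indivisible items and $n \ge 1$ agents, with $m \ge 2n$. An allocation assigns each item to exactly one agent; $A_i$ denotes the set of items of agent $i$. Agent $i$ has a valuation $v_i$ from sets of items to the nonnegative reals. Write $v(e)=v(\{e\})$. A valuation $v$ is \emph{unit demand} if $v(S)=\max_{e\in S}v(e)$ (and $v(\emptyset)=0$), \emph{additive} if $v(S)=\sum_{e\in S}v(e)$, \emph{binary} if it is additive with all $v(e)\in\{0,1\}$, and \emph{2-valued}, for publicly known values $a>b\ge 0$ common to all agents, if it is additive with all $v(e)\in\{a,b\}$. The maximin share (MMS) of agent $i$ is $\max_P\min_{S\in P}v_i(S)$ over all partitions $P$ of the items into $n$ (possibly empty) sets, and an MMS allocation is one in which $v_i(A_i)$ is at least the MMS of agent $i$, for every $i$. In a deterministic protocol each $v_i$ is known only to agent $i$; agents answer publicly, in bits, queries about their own valuations (queries may depend on earlier answers), and the sequence of answers determines the output allocation. The deterministic communication complexity $CC$ of MMS allocations on a class of instances is the smallest worst-case total number of bits sent, over all protocols that output an MMS allocation on every instance of the class. Logarithms are to base 2, and all constants hidden in $O$, $\Omega$, $\Theta$ are absolute. (1) For all $n\ge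 1$ and $m\ge 2n$: \begin{itemize} \item for unit demand valuations, $CC = O\left(n\left(\log n+\log\log\frac mn\right)\right)$; \item for binary valuations, $CC = O(n\log m\log n)$; \item for 2-valued valuations, for every $a>b\ge 0$, $CC = O(m\log n)$; in fact some protocol attains this with each single agent sending only $O\left(\frac mn\log n\right)$ bits. \end{itemize} (2) On instances in which all agents have the same valuation (upper bounds for $n\ge 1$, lower bounds for $n\ge 2$, always with $m\ge 2n$): \begin{itemize} \item for unit demand valuations, $CC = \Theta(n+\log\log m)$; \item for binary valuations, $CC = \Omega\left(n\log\frac mn\right)$; \item for 2-valued valuations, $CC=\Theta(m)$: $CC=O(m)$ for every $a>b\ge 0$, and for all $n$ and $m$ there are $a>b\ge0$ for which $CC=\Omega(m)$. \end{itemize} -/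

import Mathlib

/-- A valuation function on sets of the `m` items `Fin m`. -/
abbrev ItemValuation (m : ℕ) : Type := Finset (Fin m) → ℝ

/-- An allocation of `m` items to `n` agents: every item goes to exactly one agent.
Bundles may be empty. The same type serves for (labelled) partitions into `n` sets. -/
abbrev Allocation (n m : ℕ) : Type := Fin m → Fin n

/-- The set of items that agent `i` receives. -/
def bundle {n m : ℕ} (A : Allocation n m) (i : Fin n) : Finset (Fin m) :=
  Finset.univ.filter fun e => A e = i

/-- Unit demand: the value of a set is the largest value of an item in it. -/
def IsUnitDemand {m : ℕ} (v : ItemValuation m) : Prop :=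
  (∀ e, 0 ≤ v {e}) ∧ v ∅ = 0 ∧
    ∀ (S : Finset (Fin m)) (hS : S.Nonempty), v S = S.sup' hS fun e => v {e}

/-- Additive: the value of a set is the sum of the values of its items. -/
def IsAdditive {m : ℕ} (v : ItemValuation m) : Prop :=
  (∀ e, 0 ≤ v {e}) ∧ ∀ S : Finset (Fin m), v S = ∑ e ∈ S, v {e}

/-- Binary additive: additive, every item has value 0 or 1. -/
def IsBinary {m : ℕ} (v : ItemValuation m) : Prop :=
  IsAdditive v ∧ ∀ e, v {e} = 0 ∨ v {e} = 1

/-- 2-valued additive with values `a` and `b`. -/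
def IsTwoValued {m : ℕ} (a b : ℝ) (v : ItemValuation m) : Prop :=
  IsAdditive v ∧ ∀ e, v {e} = a ∨ v {e} = b

/-- The maximin share: the largest, over all partitions of the items into `n` bundles, of the
least value of a bundle. For `1 ≤ n` both extrema are over nonempty finite sets. -/
noncomputable def mms (n : ℕ) {m : ℕ} (v : ItemValuation m) : ℝ :=
  ⨆ P : Allocation n m, ⨅ j : Fin n, v (bundle P j)

/-- Every agent gets at least her maximin share. -/
def IsMMSAllocation {n m : ℕ} (v : Fin n → ItemValuation m) (A : Allocation n m) : Prop :=
  ∀ i, mms n (v i) ≤ v i (bundle A i)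

/-- A deterministic protocol. At every step either an allocation is output or some agent `i`
is asked an arbitrary yes/no question about her own valuation, and the protocol continues
according to the answer. A query with a longer answer is a sequence of such questions. -/
inductive Protocol (n m : ℕ) : Type
  | output (A : Allocation n m) : Protocol n m
  | query (i : Fin n) (q : ItemValuation m → Bool) (next : Bool → Protocol n m) : Protocol n m

namespace Protocol

variable {n m : ℕ}

/-- The list of replies (sender and transmitted bit) when the valuations are `v`. -/
def transcript : Protocol n m → (Fin n → ItemValuation m) → List (Fin n × Bool)
  | output _, _ => []
  | query i q next, v => (i, q (v i)) :: transcript (next (q (v i))) v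

/-- The allocation that is output when the valuations are `v`. -/
def result : Protocol n m → (Fin n → ItemValuation m) → Allocation n m
  | output A, _ => A
  | query i q next, v => result (next (q (v i))) v

/-- Total number of bits transmitted by the agents. -/
def bits (P : Protocol n m) (v : Fin n → ItemValuation m) : ℕ :=
  (P.transcript v).length

/-- Number of bits transmitted by agent `i`. -/
def agentBits (P : Protocol n m) (v : Fin n → ItemValuation m) (i : Fin n) : ℕ :=
  ((P.transcript v).filter fun r => r.1 = i).length

/-- On every instance of the class `C`, the output is an MMS allocation. -/
def SolvesMMS (P : Protocol n m) (C : Set (Fin n → ItemValuation m)) : Prop :=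
  ∀ v ∈ C, IsMMSAllocation v (P.result v)

end Protocol

/-- `CC(MMS, C) ≤ B`: some protocol finds MMS allocations on the class `C`, sending at most `B`
bits on every instance. -/
def CCAtMost {n m : ℕ} (C : Set (Fin n → ItemValuation m)) (B : ℝ) : Prop :=
  ∃ P : Protocol n m, P.SolvesMMS C ∧ ∀ v ∈ C, (P.bits v : ℝ) ≤ B

/-- `CC(MMS, C) ≥ B`: every protocol that finds MMS allocations on the class `C` sends at least
`B` bits on some instance. -/
def CCAtLeast {n m : ℕ} (C : Set (Fin n → ItemValuation m)) (B : ℝ) : Prop :=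
  ∀ P : Protocol n m, P.SolvesMMS C → ∃ v ∈ C, B ≤ (P.bits v : ℝ)

/-- Instances in which every valuation belongs to the class `K`. -/
def instances (n : ℕ) {m : ℕ} (K : ItemValuation m → Prop) : Set (Fin n → ItemValuation m) :=
  {v | ∀ i, K (v i)}

/-- Instances in which all agents have the same valuation, from the class `K`. -/
def identicalInstances (n : ℕ) {m : ℕ} (K : ItemValuation m → Prop) : Set (Fin n → ItemValuation m) :=
  {v | ∃ u, K u ∧ ∀ i, v i = u}

/-!
All protocols are built from dialogues that compute public information step by step.

* Unit demand: some hash function into a set of `poly(n, log m)` values is injective on everybody's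
  `n` best items. The agents agree on one bit by bit, by estimating the total number of collisions
  in both halves of a Reed–Solomon family, and then take turns to pick hash values.
* Binary: divide and choose by median cuts of the line of items, with `log n` levels of recursion.
* 2-valued: the numbers of large items alone determine sizes of bundles for which the agents can
  pick in turn, in increasing order of their numbers of large items.
* Identical valuations: for unit demand, a perfect hash family of size `2 ^ O(n) * log m` is known
  in advance, and one agent names a member of it; in the 2-valued case she sends her large items.

A protocol with `k` bits has at most `2 ^ k` outputs, so the lower bounds count the allocations that
are needed for all instances. If the instances are the `n * t`-sets of valuable items, then the
family of outputs has to split every such set evenly. The 2-valued bound uses item values `h + 2`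
and `h` for which at most one bundle may exceed its share, and by only one unit: the number of large
items in each bundle is then forced by its size, and an allocation serves few instances.
-/

/-- A decision tree over the private inputs of the agents `ι`, each of which lies in `X`; it is a
protocol whose leaves carry public information of an arbitrary type. Protocols are assembled from
dialogues that transmit partial information. -/
inductive Dialogue (ι X α : Type*)
  | done (a : α) : Dialogue ι X α
  | ask (i : ι) (q : X → Bool) (next : Bool → Dialogue ι X α) : Dialogue ι X α

namespace Dialogue

section General

variable {ι X α β : Type*}

/-- The public information at the end of a dialogue. -/
def run : Dialogue ι X α → (ι → X) → α
  | done a, _ => a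
  | ask i q next, v => run (next (q (v i))) v

/-- The number of bits sent by each agent in the course of a dialogue. -/
def cost [DecidableEq ι] : Dialogue ι X α → (ι → X) → ι → ℕ
  | done _, _ => 0
  | ask i q next, v => Pi.single i 1 + cost (next (q (v i))) v

/-- Sequential composition: the second dialogue depends on the outcome of the first one. -/
def bind : Dialogue ι X α → (α → Dialogue ι X β) → Dialogue ι X β
  | done a, f => f a
  | ask i q next, f => ask i q fun b => bind (next b) f

@[simp] theorem run_done (a : α) (v : ι → X) : (done a).run v = a := rfl

@[simp] theorem run_bind (t : Dialogue ι X α) (f : α → Dialogue ι X β) (v : ι → X) :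
    (t.bind f).run v = (f (t.run v)).run v := by
  induction t with
  | done a => rfl
  | ask i q _ ih => exact ih (q (v i))

/-- Agent `i` sends a word of `L` bits. -/
def sendBits (i : ι) : (L : ℕ) → (X → Fin L → Bool) → Dialogue ι X (Fin L → Bool)
  | 0, _ => done Fin.elim0
  | L + 1, f => ask i (fun x => f x 0) fun b =>
      (sendBits i L fun x => Fin.tail (f x)).bind fun w => done (Fin.cons b w)

@[simp] theorem run_sendBits (i : ι) (L : ℕ) (f : X → Fin L → Bool) (v : ι → X) :
    (sendBits i L f).run v = f (v i) := by
  induction L with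
  | zero => exact Subsingleton.elim _ _
  | succ L ih => simp only [sendBits, run, run_bind, ih, Fin.cons_self_tail]

/-- Agent `i` sends a number in unary, truncated at `K`. -/
def sendUnary (i : ι) : ℕ → (X → ℕ) → Dialogue ι X ℕ
  | 0, _ => done 0
  | K + 1, f => ask i (fun x => f x = 0) fun b =>
      if b then done 0 else (sendUnary i K fun x => f x - 1).bind fun a => done (a + 1)

theorem run_sendUnary (i : ι) {K : ℕ} {f : X → ℕ} {v : ι → X} (h : f (v i) ≤ K) :
    (sendUnary i K f).run v = f (v i) := by
  induction K generalizing f with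
  | zero => simpa [sendUnary] using h.antisymm' (Nat.zero_le _)
  | succ K ih =>
    by_cases h0 : f (v i) = 0
    · simp [sendUnary, run, h0]
    · simp only [sendUnary, run, h0, decide_false, Bool.false_eq_true, if_false, run_bind]
      rw [ih (f := fun x => f x - 1) (by omega), Nat.sub_add_cancel (by omega)]

end General

section Cost

variable {ι X α β : Type*} [DecidableEq ι]

@[simp] theorem cost_done (a : α) (v : ι → X) : (done a : Dialogue ι X α).cost v = 0 := rfl

@[simp] theorem cost_bind (t : Dialogue ι X α) (f : α → Dialogue ι X β) (v : ι → X) :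
    (t.bind f).cost v = t.cost v + (f (t.run v)).cost v := by
  induction t with
  | done a => simp [bind]
  | ask i q _ ih => simp only [bind, cost, run, ih, add_assoc]

@[simp] theorem cost_sendBits (i : ι) (L : ℕ) (f : X → Fin L → Bool) (v : ι → X) :
    (sendBits i L f).cost v = Pi.single i L := by
  induction L with
  | zero => simp [sendBits]
  | succ L ih => simp [sendBits, cost, ih, ← Pi.single_add, add_comm]

theorem exists_send [Finite α] [Nonempty α] (i : ι) {L : ℕ} (hL : Nat.card α ≤ 2 ^ L)
    (f : X → α) : ∃ t : Dialogue ι X α, ∀ v, t.run v = f (v i) ∧ t.cost v = Pi.single i L := by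
  have := Fintype.ofFinite α
  obtain ⟨code⟩ : Nonempty (α ↪ (Fin L → Bool)) :=
    Function.Embedding.nonempty_of_card_le (by simpa [Nat.card_eq_fintype_card] using hL)
  refine ⟨(sendBits i L fun x => code (f x)).bind fun w => done (Function.invFun code w),
    fun v => ⟨?_, by simp⟩⟩
  simpa using Function.leftInverse_invFun code.injective (f (v i))

theorem cost_sendUnary_le (i : ι) (K : ℕ) (f : X → ℕ) (v : ι → X) :
    (sendUnary i K f).cost v ≤ Pi.single i (f (v i) + 1) := by
  induction K generalizing f with
  | zero => simp [sendUnary]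
  | succ K ih =>
    by_cases h0 : f (v i) = 0
    · simp [sendUnary, cost, h0]
    · simp only [sendUnary, cost, h0, decide_false, Bool.false_eq_true, if_false, cost_bind]
      refine (add_le_add_right (ih _) _).trans ?_
      rw [← Pi.single_add, show 1 + (f (v i) - 1 + 1) = f (v i) + 1 by omega]

theorem exists_gather [Nonempty α] (d : ι → Dialogue ι X α) (G : Finset ι) :
    ∃ t : Dialogue ι X (ι → α), ∀ v, (∀ i ∈ G, t.run v i = (d i).run v) ∧
      t.cost v = ∑ i ∈ G, (d i).cost v := by
  induction G using Finset.induction_on with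
  | empty => exact ⟨done fun _ => Classical.arbitrary α, fun v => by simp⟩
  | insert i G hi ih =>
    obtain ⟨t, ht⟩ := ih
    refine ⟨t.bind fun g => (d i).bind fun a => done (Function.update g i a), fun v => ?_⟩
    obtain ⟨hrun, hcost⟩ := ht v
    refine ⟨fun j hj => ?_, by simp [Finset.sum_insert hi, hcost, add_comm]⟩
    rcases Finset.mem_insert.1 hj with rfl | hj
    · simp
    · simp [Function.update_of_ne (ne_of_mem_of_not_mem hj hi), hrun j hj]

theorem exists_broadcast [Finite ι] [Finite α] [Nonempty α] {L : ℕ} (hL : Nat.card α ≤ 2 ^ L)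
    (f : X → α) : ∃ t : Dialogue ι X (ι → α), ∀ v, t.run v = f ∘ v ∧ t.cost v = fun _ => L := by
  have := Fintype.ofFinite ι
  choose send hsend using fun i : ι => exists_send i hL f
  obtain ⟨t, ht⟩ := exists_gather send Finset.univ
  refine ⟨t, fun v => ⟨funext fun i => ?_, ?_⟩⟩
  · rw [(ht v).1 i (Finset.mem_univ i), (hsend i v).1, Function.comp_apply]
  · simp only [(ht v).2, hsend, Finset.univ_sum_single]

end Cost

section ToProtocol

variable {n m : ℕ}

/-- A dialogue that ends with an allocation, read as a protocol. -/
def toProtocol : Dialogue (Fin n) (ItemValuation m) (Allocation n m) → Protocol n m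
  | done A => .output A
  | ask i q next => .query i q fun b => toProtocol (next b)

theorem result_toProtocol (t : Dialogue (Fin n) (ItemValuation m) (Allocation n m))
    (v : Fin n → ItemValuation m) : t.toProtocol.result v = t.run v := by
  induction t with
  | done A => rfl
  | ask i q _ ih => exact ih (q (v i))

theorem agentBits_toProtocol (t : Dialogue (Fin n) (ItemValuation m) (Allocation n m))
    (v : Fin n → ItemValuation m) (i : Fin n) : t.toProtocol.agentBits v i = t.cost v i := by
  induction t with
  | done A => rfl
  | ask j q _ ih =>
    have ih := ih (q (v j))
    simp only [Protocol.agentBits] at ih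
    simp only [Protocol.agentBits, toProtocol, Protocol.transcript, List.filter_cons, cost,
      Pi.add_apply, ← ih]
    by_cases h : j = i
    · subst h; simp [add_comm]
    · simp [h, Ne.symm h]

theorem bits_toProtocol (t : Dialogue (Fin n) (ItemValuation m) (Allocation n m))
    (v : Fin n → ItemValuation m) : t.toProtocol.bits v = ∑ i, t.cost v i := by
  induction t with
  | done A => simp [toProtocol, Protocol.bits, Protocol.transcript]
  | ask j q _ ih =>
    have ih := ih (q (v j))
    simp only [Protocol.bits] at ih
    simp [Protocol.bits, toProtocol, Protocol.transcript, cost, Finset.sum_add_distrib, ih,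
      add_comm]

end ToProtocol

end Dialogue

theorem CCAtMost.of_dialogue {n m : ℕ} {C : Set (Fin n → ItemValuation m)} {B : ℝ}
    (t : Dialogue (Fin n) (ItemValuation m) (Allocation n m))
    (h : ∀ v ∈ C, IsMMSAllocation v (t.run v))
    (hB : ∀ v ∈ C, ((∑ i, t.cost v i : ℕ) : ℝ) ≤ B) : CCAtMost C B :=
  ⟨t.toProtocol, fun v hv => t.result_toProtocol v ▸ h v hv,
    fun v hv => t.bits_toProtocol v ▸ hB v hv⟩

namespace Protocol

variable {n m : ℕ}

/-- The allocations at the leaves of depth at most `k`. -/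
def outputs : Protocol n m → ℕ → Finset (Allocation n m)
  | output A, _ => {A}
  | query _ _ _, 0 => ∅
  | query _ _ next, k + 1 => outputs (next true) k ∪ outputs (next false) k

theorem card_outputs_le (P : Protocol n m) (k : ℕ) : (P.outputs k).card ≤ 2 ^ k := by
  induction P generalizing k with
  | output _ => exact Nat.one_le_two_pow
  | query i q next ih =>
    cases k with
    | zero => exact Nat.zero_le _
    | succ k =>
      refine (Finset.card_union_le _ _).trans ?_
      rw [pow_succ, mul_two]
      exact add_le_add (ih true k) (ih false k)

theorem result_mem_outputs {P : Protocol n m} {v : Fin n → ItemValuation m} {k : ℕ}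
    (h : P.bits v ≤ k) : P.result v ∈ P.outputs k := by
  induction P generalizing k with
  | output A => exact Finset.mem_singleton_self A
  | query i q next ih =>
    simp only [bits, transcript, List.length_cons] at h ih
    obtain ⟨k, rfl⟩ := Nat.exists_eq_add_of_lt (Nat.lt_of_succ_le h)
    have hmem := @ih (q (v i)) _ (Nat.le_add_right _ k)
    rw [outputs, Finset.mem_union]
    cases hq : q (v i) <;> simp only [result, hq] at hmem ⊢
    exacts [.inr hmem, .inl hmem]

end Protocol

theorem CCAtLeast.of_outputs {n m : ℕ} {C : Set (Fin n → ItemValuation m)} {X : ℝ}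
    (hC : C.Nonempty)
    (h : ∀ F : Finset (Allocation n m), (∀ v ∈ C, ∃ A ∈ F, IsMMSAllocation v A) →
      X ≤ Real.logb 2 F.card) : CCAtLeast C X := by
  intro P hP
  by_contra! hcon
  obtain ⟨v₀, hv₀⟩ := hC
  obtain ⟨k, hk⟩ : ∃ k, ⌈X⌉₊ = k + 1 :=
    Nat.exists_eq_add_one.2 (Nat.ceil_pos.2 ((Nat.cast_nonneg _).trans_lt (hcon v₀ hv₀)))
  have hmem : ∀ v ∈ C, P.result v ∈ P.outputs k := fun v hv => by
    have hbits := Nat.lt_ceil.2 (hcon v hv)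
    exact Protocol.result_mem_outputs (by omega)
  have hcard : 0 < (P.outputs k).card := Finset.card_pos.2 ⟨_, hmem v₀ hv₀⟩
  have hlog : Real.logb 2 (P.outputs k).card ≤ k := by
    rw [Real.logb_le_iff_le_rpow one_lt_two (by exact_mod_cast hcard), Real.rpow_natCast]
    exact_mod_cast P.card_outputs_le k
  have hkX : (k : ℝ) < X := Nat.lt_ceil.1 (by omega)
  exact absurd (h _ fun v hv => ⟨_, hmem v hv, hP v hv⟩) (not_le.2 (hlog.trans_lt hkX))

section Basics

variable {n m : ℕ}

@[simp] theorem mem_bundle {A : Allocation n m} {i : Fin n} {e : Fin m} :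
    e ∈ bundle A i ↔ A e = i := by simp [bundle]

theorem sum_card_inter_bundle (A : Allocation n m) (K : Finset (Fin m)) :
    ∑ i, (K ∩ bundle A i).card = K.card := by
  rw [Finset.card_eq_sum_card_fiberwise (f := A) (t := Finset.univ) (by simp)]
  refine Finset.sum_congr rfl fun i _ => congrArg _ ?_
  ext e; simp

theorem sum_card_bundle (A : Allocation n m) : ∑ i, (bundle A i).card = m := by
  simpa using sum_card_inter_bundle A Finset.univ

section MaximinShare

variable [NeZero n]

theorem mms_le {v : ItemValuation m} {x : ℝ}
    (h : ∀ P : Allocation n m, ∃ j, v (bundle P j) ≤ x) : mms n v ≤ x := by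
  refine ciSup_le fun P => ?_
  obtain ⟨j, hj⟩ := h P
  exact (ciInf_le (Set.finite_range _).bddBelow j).trans hj

theorem le_mms {v : ItemValuation m} {x : ℝ} (P : Allocation n m)
    (h : ∀ j, x ≤ v (bundle P j)) : x ≤ mms n v :=
  (le_ciInf h).trans (le_ciSup (f := fun P : Allocation n m => ⨅ j, v (bundle P j))
    (Set.finite_range _).bddAbove P)

theorem exists_mms_partition (v : ItemValuation m) :
    ∃ P : Allocation n m, ∀ j, mms n v ≤ v (bundle P j) := by
  obtain ⟨P, hP⟩ := exists_eq_ciSup_of_finite (f := fun P : Allocation n m => ⨅ j, v (bundle P j))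
  refine ⟨P, fun j => ?_⟩
  rw [mms, ← hP]
  exact ciInf_le (Set.finite_range _).bddBelow j

end MaximinShare

theorem isMMSAllocation_one (v : Fin 1 → ItemValuation m) (A : Allocation 1 m) :
    IsMMSAllocation v A := fun i =>
  mms_le fun P => ⟨i, by rw [Subsingleton.elim P A]⟩

theorem CCAtMost.one_agent (C : Set (Fin 1 → ItemValuation m)) {B : ℝ} (hB : 0 ≤ B) :
    CCAtMost C B :=
  CCAtMost.of_dialogue (.done fun _ => 0) (fun v _ => isMMSAllocation_one v _)
    (fun v _ => by simpa using hB)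

theorem exists_card_fiber_ge {α κ : Type*} [Fintype κ] [DecidableEq κ] [Nonempty κ]
    (S : Finset α) (x : κ → ℕ) (h : ∑ i, x i ≤ S.card) :
    ∃ f : α → κ, ∀ i, x i ≤ {e ∈ S | f e = i}.card := by
  obtain ⟨g⟩ : Nonempty ((Σ i, Fin (x i)) ↪ S) :=
    Function.Embedding.nonempty_of_card_le (by simpa using h)
  have hg : Function.Injective fun p => (g p : α) := Subtype.val_injective.comp g.injective
  refine ⟨Function.extend (fun p => (g p : α)) Sigma.fst fun _ => Classical.arbitrary κ,
    fun i => ?_⟩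
  calc x i = (Finset.univ : Finset (Fin (x i))).card := by simp
    _ ≤ _ := Finset.card_le_card_of_injOn (fun r => (g ⟨i, r⟩ : α))
      (fun r _ => by simp [hg.extend_apply])
      (hg.comp sigma_mk_injective).injOn

theorem exists_allocation_extending [NeZero n] (S : Fin n → Finset (Fin m))
    (hS : Pairwise fun i j => Disjoint (S i) (S j)) (s : Fin n → ℕ) (hSs : ∀ i, (S i).card ≤ s i)
    (hs : ∑ i, s i ≤ m) :
    ∃ A : Allocation n m, ∀ i, S i ⊆ bundle A i ∧ s i ≤ (bundle A i).card := by
  classical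
  set U := Finset.univ.biUnion S with hU
  have hsub : ∀ i, S i ⊆ U := fun i => Finset.subset_biUnion_of_mem S (Finset.mem_univ i)
  obtain ⟨f, hf⟩ := exists_card_fiber_ge Uᶜ (fun i => s i - (S i).card) (by
    have h1 : ∑ i, (s i - (S i).card) + ∑ i, (S i).card = ∑ i, s i := by
      rw [← Finset.sum_add_distrib]
      exact Finset.sum_congr rfl fun i _ => Nat.sub_add_cancel (hSs i)
    rw [Finset.card_compl, hU, Finset.card_biUnion fun i _ j _ hij => hS hij, Fintype.card_fin]
    omega)
  have hexists : ∀ e, ∃ j, (∀ i, e ∈ S i → j = i) ∧ (e ∈ Uᶜ → j = f e) := by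
    intro e
    by_cases he : e ∈ U
    · obtain ⟨j, -, hj⟩ := Finset.mem_biUnion.1 he
      exact ⟨j, fun i hi => hS.eq (Finset.not_disjoint_iff.2 ⟨e, hj, hi⟩), by simp [he]⟩
    · exact ⟨f e, fun i hi => absurd (hsub i hi) he, fun _ => rfl⟩
  choose A hAS hAf using hexists
  refine ⟨A, fun i => ⟨fun e he => mem_bundle.2 (hAS e i he), ?_⟩⟩
  have hdisj : Disjoint (S i) {e ∈ Uᶜ | f e = i} :=
    (disjoint_compl_right.mono_left (hsub i)).mono_right (Finset.filter_subset _ _)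
  calc s i ≤ (S i).card + {e ∈ Uᶜ | f e = i}.card := by have := hf i; omega
    _ = (S i ∪ {e ∈ Uᶜ | f e = i}).card := (Finset.card_union_of_disjoint hdisj).symm
    _ ≤ (bundle A i).card := Finset.card_le_card <| Finset.union_subset
        (fun e he => mem_bundle.2 (hAS e i he)) fun e he => by
          rw [Finset.mem_filter] at he
          exact mem_bundle.2 ((hAf e he.1).trans he.2)

theorem exists_top_subset {ι κ : Type*} [DecidableEq ι] [LinearOrder κ] (S : Finset ι)
    (f : ι → κ) {k : ℕ} (hk : k ≤ S.card) :
    ∃ T ⊆ S, T.card = k ∧ ∀ e ∈ T, ∀ e' ∈ S \ T, f e' ≤ f e := by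
  induction k with
  | zero => exact ⟨∅, by simp⟩
  | succ k ih =>
    obtain ⟨T, hT, hTc, h⟩ := ih (by omega)
    have hne : (S \ T).Nonempty := by
      rw [← Finset.card_pos, Finset.card_sdiff_of_subset hT]; omega
    obtain ⟨x, hx, hmax⟩ := Finset.exists_max_image (S \ T) f hne
    have hxS := Finset.mem_sdiff.1 hx
    refine ⟨insert x T, Finset.insert_subset hxS.1 hT, ?_, fun e he e' he' => ?_⟩
    · rw [Finset.card_insert_of_notMem hxS.2, hTc]
    · have he'' : e' ∈ S \ T :=
          Finset.sdiff_subset_sdiff Finset.Subset.rfl (Finset.subset_insert x T) he'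
      rcases Finset.mem_insert.1 he with rfl | he
      · exact hmax e' he''
      · exact h e he e' he''

theorem card_filter_inter_bundle_le (A : Allocation n m) (U : Finset (Fin m)) (x : Fin n → ℕ) :
    {K ∈ U.powerset | ∀ i, (K ∩ bundle A i).card = x i}.card
      ≤ ∏ i, (U ∩ bundle A i).card.choose (x i) := by
  have hcard : ∏ i, (U ∩ bundle A i).card.choose (x i)
      = (Fintype.piFinset fun i => Finset.powersetCard (x i) (U ∩ bundle A i)).card := by
    simp [Fintype.card_piFinset]
  rw [hcard]
  refine Finset.card_le_card_of_injOn (fun K i => K ∩ bundle A i) (fun K hK => ?_) ?_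
  · obtain ⟨hKU, hKx⟩ := Finset.mem_filter.1 hK
    simp only [Finset.mem_coe, Fintype.mem_piFinset, Finset.mem_powersetCard]
    exact fun i => ⟨Finset.inter_subset_inter_right (Finset.mem_powerset.1 hKU), hKx i⟩
  · intro K _ K' _ h
    ext e
    simpa using Finset.ext_iff.1 (congrFun h (A e)) e

theorem choose_le_sum_prod_choose (F : Finset (Allocation n m)) (U : Finset (Fin m)) {k : ℕ}
    (x : Allocation n m → Fin n → ℕ)
    (h : ∀ K ⊆ U, K.card = k → ∃ A ∈ F, ∀ i, (K ∩ bundle A i).card = x A i) :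
    U.card.choose k ≤ ∑ A ∈ F, ∏ i, (U ∩ bundle A i).card.choose (x A i) := by
  calc U.card.choose k = (U.powersetCard k).card := (Finset.card_powersetCard k U).symm
    _ ≤ (F.biUnion fun A => {K ∈ U.powerset | ∀ i, (K ∩ bundle A i).card = x A i}).card :=
        Finset.card_le_card fun K hK => by
          obtain ⟨hKU, hKk⟩ := Finset.mem_powersetCard.1 hK
          obtain ⟨A, hA, hKx⟩ := h K hKU hKk
          exact Finset.mem_biUnion.2
            ⟨A, hA, Finset.mem_filter.2 ⟨Finset.mem_powerset.2 hKU, hKx⟩⟩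
    _ ≤ _ := Finset.card_biUnion_le.trans
        (Finset.sum_le_sum fun A _ => card_filter_inter_bundle_le A U (x A))

end Basics

section TwoValue

variable {n m : ℕ} {a b : ℝ}

/-- The additive valuation with value `a` on the items of `K` and `b` on the other ones, the normal
form of a 2-valued valuation. -/
def twoValue (a b : ℝ) (K : Finset (Fin m)) : ItemValuation m :=
  fun S => ∑ e ∈ S, if e ∈ K then a else b

theorem twoValue_singleton (a b : ℝ) (K : Finset (Fin m)) (e : Fin m) :
    twoValue a b K {e} = if e ∈ K then a else b := by simp [twoValue]

theorem isTwoValued_twoValue (hb : 0 ≤ b) (hab : b ≤ a) (K : Finset (Fin m)) :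
    IsTwoValued a b (twoValue a b K) := by
  refine ⟨⟨fun e => ?_, fun S => ?_⟩, fun e => ?_⟩
  · rw [twoValue_singleton]; split_ifs <;> linarith
  · simp [twoValue]
  · rw [twoValue_singleton]; split_ifs <;> simp

/-- The items of value `a`; together with `a` and `b` they determine a 2-valued valuation. -/
noncomputable def bigItems (a : ℝ) (v : ItemValuation m) : Finset (Fin m) :=
  {e | v {e} = a}

theorem IsTwoValued.eq_twoValue {v : ItemValuation m} (h : IsTwoValued a b v) :
    v = twoValue a b (bigItems a v) := by
  funext S
  rw [h.1.2, twoValue]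
  refine Finset.sum_congr rfl fun e _ => ?_
  rcases h.2 e with he | he
  · simp [bigItems, he]
  · by_cases hba : b = a
    · simp [he, hba]
    · simp [bigItems, he, hba]

theorem twoValue_eq (a b : ℝ) (K S : Finset (Fin m)) :
    twoValue a b K S = b * S.card + (a - b) * (K ∩ S).card := by
  rw [twoValue, Finset.sum_ite, ← Finset.card_sdiff_add_card_inter S K]
  simp only [Finset.sum_const, nsmul_eq_mul, Finset.filter_mem_eq_inter,
    Finset.filter_notMem_eq_sdiff, Finset.inter_comm S K]
  push_cast; ring

theorem isBinary_iff_isTwoValued {v : ItemValuation m} : IsBinary v ↔ IsTwoValued 1 0 v := by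
  simp only [IsBinary, IsTwoValued, or_comm]

variable [NeZero n]

theorem le_mms_twoValue {μ : ℝ} (hb : 0 ≤ b) (hab : b ≤ a)
    (K : Finset (Fin m)) (x s : Fin n → ℕ) (hx : ∑ i, x i ≤ K.card) (hs : ∑ i, s i ≤ m)
    (hxs : ∀ i, x i ≤ s i) (h : ∀ i, μ ≤ b * s i + (a - b) * x i) :
    μ ≤ mms n (twoValue a b K) := by
  obtain ⟨f, hf⟩ := exists_card_fiber_ge K x hx
  choose S hS hSc using fun i => Finset.exists_subset_card_eq (hf i)
  have hdisj : Pairwise fun i j => Disjoint (S i) (S j) := fun i j hij =>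
    Finset.disjoint_left.2 fun e hi hj =>
      hij ((Finset.mem_filter.1 (hS i hi)).2.symm.trans (Finset.mem_filter.1 (hS j hj)).2)
  obtain ⟨A, hA⟩ := exists_allocation_extending S hdisj s (fun i => (hSc i).trans_le (hxs i)) hs
  refine le_mms A fun i => (h i).trans ?_
  rw [twoValue_eq]
  gcongr
  · exact (hA i).2
  · rw [← hSc i]
    exact Finset.card_le_card fun e he =>
      Finset.mem_inter.2 ⟨(Finset.mem_filter.1 (hS i he)).1, (hA i).1 he⟩

theorem mms_twoValue_mono (hb : 0 ≤ b) (hab : b ≤ a) {K K' : Finset (Fin m)}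
    (h : K.card ≤ K'.card) : mms n (twoValue a b K) ≤ mms n (twoValue a b K') := by
  obtain ⟨P, hP⟩ := exists_mms_partition (n := n) (twoValue a b K)
  refine le_mms_twoValue hb hab K' (fun i => (K ∩ bundle P i).card)
    (fun i => (bundle P i).card) (by rwa [sum_card_inter_bundle]) (sum_card_bundle P).le
    (fun i => Finset.card_le_card Finset.inter_subset_right) fun i => ?_
  rw [← twoValue_eq]
  exact hP i

theorem mms_twoValue_le (hb : 0 ≤ b) (hab : b ≤ a) {r : ℕ} (hr : m ≤ n * r)
    (K : Finset (Fin m)) : mms n (twoValue a b K) ≤ a * r := by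
  refine mms_le fun P => ?_
  obtain ⟨j, -, hj⟩ : ∃ j ∈ Finset.univ, (bundle P j).card ≤ r :=
    Finset.exists_le_of_sum_le Finset.univ_nonempty (by simpa [sum_card_bundle] using hr)
  refine ⟨j, ?_⟩
  have hK : ((K ∩ bundle P j).card : ℝ) ≤ r := by
    exact_mod_cast (Finset.card_le_card Finset.inter_subset_right).trans hj
  have hj : ((bundle P j).card : ℝ) ≤ r := by exact_mod_cast hj
  calc twoValue a b K (bundle P j) ≤ b * r + (a - b) * r := by
        rw [twoValue_eq]
        gcongr
    _ = a * r := by ring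

end TwoValue

theorem logb_two_le_self {x : ℝ} (hx : 0 ≤ x) : Real.logb 2 x ≤ x := by
  rcases hx.eq_or_lt with rfl | hx
  · simp
  have hlog : Real.exp 1 * Real.log x ≤ x := by
    simpa [Real.exp_log hx] using Real.exp_one_mul_le_exp (x := Real.log x)
  have he : 1 ≤ Real.exp 1 * Real.log 2 := by
    nlinarith [Real.exp_one_gt_d9, Real.log_two_gt_d9]
  rw [Real.logb, div_le_iff₀ (Real.log_pos one_lt_two)]
  refine le_of_mul_le_mul_left (hlog.trans ?_) (Real.exp_pos 1)
  nlinarith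

theorem one_le_logb_two {x : ℝ} (hx : 2 ≤ x) : 1 ≤ Real.logb 2 x := by
  rw [Real.le_logb_iff_rpow_le one_lt_two (by linarith), Real.rpow_one]
  exact hx

theorem sixteen_pow_le_centralBinom_sq {k : ℕ} (hk : 1 ≤ k) :
    16 ^ k ≤ 4 * k * k.centralBinom ^ 2 := by
  induction k, hk using Nat.le_induction with
  | base => simp [Nat.centralBinom]
  | succ k hk ih =>
    have h := Nat.succ_mul_centralBinom_succ k
    refine Nat.le_of_mul_le_mul_left (c := k * (k + 1)) ?_ (by positivity)
    calc k * (k + 1) * 16 ^ (k + 1) = (k * (k + 1) * 16) * 16 ^ k := by ring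
      _ ≤ (k * (k + 1) * 16) * (4 * k * k.centralBinom ^ 2) := by gcongr
      _ = 16 * k * (4 * k * (k + 1)) * k.centralBinom ^ 2 := by ring
      _ ≤ 16 * k * ((2 * k + 1) ^ 2) * k.centralBinom ^ 2 := by gcongr; nlinarith
      _ = 4 * k * (2 * (2 * k + 1) * k.centralBinom) ^ 2 := by ring
      _ = k * (k + 1) * (4 * (k + 1) * (k + 1).centralBinom ^ 2) := by rw [← h]; ring

theorem centralBinom_sq_mul_le (k : ℕ) : k.centralBinom ^ 2 * (2 * k + 1) ≤ 16 ^ k := by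
  induction k with
  | zero => simp
  | succ k ih =>
    have h := Nat.succ_mul_centralBinom_succ k
    refine Nat.le_of_mul_le_mul_left (c := (k + 1) ^ 2) ?_ (by positivity)
    calc (k + 1) ^ 2 * ((k + 1).centralBinom ^ 2 * (2 * (k + 1) + 1))
        = ((k + 1) * (k + 1).centralBinom) ^ 2 * (2 * k + 3) := by ring
      _ = (4 * ((2 * k + 1) * (2 * k + 3))) * (k.centralBinom ^ 2 * (2 * k + 1)) := by
          rw [h]; ring
      _ ≤ (16 * (k + 1) ^ 2) * 16 ^ k := by gcongr ?_ * ?_; nlinarith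
      _ = (k + 1) ^ 2 * 16 ^ (k + 1) := by ring

theorem choose_half_sq_mul_le (s : ℕ) : s.choose (s / 2) ^ 2 * (s + 1) ≤ 4 ^ s := by
  rcases Nat.even_or_odd' s with ⟨k, rfl | rfl⟩
  · simpa [Nat.centralBinom, pow_mul] using centralBinom_sq_mul_le k
  · have hcentral : (k + 1).centralBinom = 2 * (2 * k + 1).choose k := by
      rw [Nat.centralBinom, mul_add_one, Nat.choose_succ_succ, Nat.choose_symm_half]
      ring
    have hle := centralBinom_sq_mul_le (k + 1)
    rw [hcentral, pow_succ 16] at hle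
    rw [show (2 * k + 1) / 2 = k by omega, pow_succ 4, pow_mul]
    norm_num
    nlinarith [Nat.zero_le ((2 * k + 1).choose k ^ 2)]

theorem choose_sq_mul_le (s t : ℕ) : s.choose t ^ 2 * (t + 1) ≤ 4 ^ s := by
  rcases lt_or_ge s t with h | h
  · simp [Nat.choose_eq_zero_of_lt h]
  · calc s.choose t ^ 2 * (t + 1) ≤ s.choose (s / 2) ^ 2 * (s + 1) := by
          gcongr
          exact Nat.choose_le_middle t s
      _ ≤ 4 ^ s := choose_half_sq_mul_le s

section EvenSplitting

variable {n m t : ℕ}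

/-- Every set of `n * t` items is split into equal parts by some allocation of the family `F`. For
`t = 1` the family is a perfect hash family. -/
def SplitsEvenly (F : Finset (Allocation n m)) (t : ℕ) : Prop :=
  ∀ K : Finset (Fin m), K.card = n * t → ∃ A ∈ F, ∀ i, (K ∩ bundle A i).card = t

theorem card_inter_bundle_eq_of_le {A : Allocation n m} {K : Finset (Fin m)}
    (hK : K.card = n * t) (h : ∀ i, t ≤ (K ∩ bundle A i).card) (i : Fin n) :
    (K ∩ bundle A i).card = t := by
  have hsum : ∑ _i : Fin n, t = ∑ i, (K ∩ bundle A i).card := by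
    rw [sum_card_inter_bundle, hK]; simp
  exact ((Finset.sum_eq_sum_iff_of_le fun i _ => h i).1 hsum i (Finset.mem_univ i)).symm

theorem prod_choose_sq_mul_le (A : Allocation n m) (U : Finset (Fin m)) (t : ℕ) :
    (∏ i, (U ∩ bundle A i).card.choose t) ^ 2 * (t + 1) ^ n ≤ 4 ^ U.card := by
  calc (∏ i, (U ∩ bundle A i).card.choose t) ^ 2 * (t + 1) ^ n
      = ∏ i : Fin n, ((U ∩ bundle A i).card.choose t ^ 2 * (t + 1)) := by
        rw [Finset.prod_mul_distrib, Finset.prod_pow]; simp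
    _ ≤ ∏ i : Fin n, 4 ^ (U ∩ bundle A i).card :=
        Finset.prod_le_prod' fun i _ => choose_sq_mul_le _ _
    _ = 4 ^ U.card := by rw [Finset.prod_pow_eq_pow_sum, sum_card_inter_bundle]

namespace SplitsEvenly

variable {F : Finset (Allocation n m)}

theorem pow_le (h : SplitsEvenly F t) (hn : 1 ≤ n) (ht : 1 ≤ t) (hm : 2 * (n * t) ≤ m) :
    (t + 1) ^ n ≤ 4 * (n * t) * F.card ^ 2 := by
  obtain ⟨U, -, hU⟩ := Finset.exists_subset_card_eq (s := (Finset.univ : Finset (Fin m)))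
    (n := 2 * (n * t)) (by simpa using hm)
  set N := n * t
  have hcover := choose_le_sum_prod_choose F U (fun _ _ => t) fun K _ => h K
  set Q : Allocation n m → ℕ := fun A => ∏ i, (U ∩ bundle A i).card.choose t
  have hQ : ∀ A ∈ F, Q A ^ 2 * (t + 1) ^ n ≤ 16 ^ N := fun A _ => by
    simpa [hU, pow_mul] using prod_choose_sq_mul_le A U t
  rw [hU] at hcover
  refine Nat.le_of_mul_le_mul_left (c := 16 ^ N) ?_ (by positivity)
  calc 16 ^ N * (t + 1) ^ n
      ≤ 4 * N * N.centralBinom ^ 2 * (t + 1) ^ n := by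
        gcongr
        exact sixteen_pow_le_centralBinom_sq (Nat.mul_pos hn ht)
    _ ≤ 4 * N * (F.card * ∑ A ∈ F, Q A ^ 2) * (t + 1) ^ n := by
        gcongr
        exact (Nat.pow_le_pow_left hcover 2).trans sq_sum_le_card_mul_sum_sq
    _ = 4 * N * F.card * ∑ A ∈ F, Q A ^ 2 * (t + 1) ^ n := by
        rw [← Finset.sum_mul]; ring
    _ ≤ 4 * N * F.card * (F.card * 16 ^ N) := by
        gcongr
        simpa using Finset.sum_le_card_nsmul F _ _ hQ
    _ = 16 ^ N * (4 * N * F.card ^ 2) := by ring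

theorem mul_logb_le (h : SplitsEvenly F t) (hn : 1 ≤ n) (ht : 1 ≤ t) (hm : 2 * (n * t) ≤ m) :
    n * Real.logb 2 (t + 1)
      ≤ 2 + Real.logb 2 n + Real.logb 2 (t + 1) + 2 * Real.logb 2 F.card := by
  have hpow : ((t : ℝ) + 1) ^ n ≤ 2 ^ 2 * (n * (t + 1)) * (F.card : ℝ) ^ 2 := by
    have hle : ((t : ℝ) + 1) ^ n ≤ 4 * (n * t) * (F.card : ℝ) ^ 2 := by
      exact_mod_cast h.pow_le hn ht hm
    refine hle.trans ?_
    gcongr <;> norm_num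
  have hF : (F.card : ℝ) ≠ 0 := by
    intro h0
    rw [h0] at hpow
    have : (0 : ℝ) < ((t : ℝ) + 1) ^ n := by positivity
    linarith
  have hn0 : (n : ℝ) ≠ 0 := by positivity
  have hlog := Real.logb_le_logb_of_le one_lt_two (by positivity) hpow
  rw [Real.logb_pow, Real.logb_mul (by positivity) (by positivity),
    Real.logb_mul (by positivity) (by positivity), Real.logb_mul hn0 (by positivity),
    Real.logb_pow, Real.logb_pow, Real.logb_self_eq_one one_lt_two] at hlog
  push_cast at hlog
  linarith

-- Two items that all allocations of `F` treat alike belong to an `n`-set that is never split.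
theorem le_pow_card (h : SplitsEvenly F 1) (hn : 2 ≤ n) (hm : n ≤ m) : m ≤ n ^ F.card := by
  have hinj : Function.Injective fun (e : Fin m) (A : F) => (A : Allocation n m) e := by
    intro e e' he
    by_contra hne
    obtain ⟨K, hK, hKc⟩ := Finset.exists_superset_card_eq (s := {e, e'}) (n := n)
      (by rw [Finset.card_pair hne]; exact hn) (by simpa using hm)
    obtain ⟨A, hA, hsplit⟩ := h K (by simpa using hKc)
    have hAe : A e = A e' := congrFun he ⟨A, hA⟩
    refine hne (Finset.card_le_one.1 (hsplit (A e)).le e ?_ e' ?_) <;>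
      simp [hK (show e ∈ ({e, e'} : Finset _) by simp),
        hK (show e' ∈ ({e, e'} : Finset _) by simp), hAe]
  simpa using Fintype.card_le_of_injective _ hinj

theorem one_le_logb_card (h : SplitsEvenly F 1) (hn : 2 ≤ n) (hm : n < m) :
    1 ≤ Real.logb 2 F.card := by
  have hlt : n ^ 1 < n ^ F.card := by simpa using hm.trans_le (h.le_pow_card hn hm.le)
  have hF : 2 ≤ F.card := (Nat.pow_lt_pow_iff_right hn).1 hlt
  exact one_le_logb_two (by exact_mod_cast hF)

theorem le_twelve_mul_logb_card (h : SplitsEvenly F 1) (hn : 2 ≤ n) (hm : 2 * n ≤ m) :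
    (n : ℝ) ≤ 12 * Real.logb 2 F.card := by
  have hF := h.one_le_logb_card hn (by omega)
  have hpow := h.mul_logb_le (by omega) le_rfl (by omega)
  have htwo : Real.logb 2 ((1 : ℕ) + 1) = 1 := by norm_num
  have hlogn : Real.logb 2 n - 1 ≤ n / 2 := by
    have hle := logb_two_le_self (x := n / 2) (by positivity)
    rwa [Real.logb_div (by positivity) two_ne_zero, Real.logb_self_eq_one one_lt_two] at hle
  rw [htwo] at hpow
  linarith

end SplitsEvenly

/-- The unit demand valuation with prescribed item values. -/
noncomputable def unitDemandOf (w : Fin m → ℝ) : ItemValuation m :=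
  fun S => if hS : S.Nonempty then S.sup' hS w else 0

theorem isUnitDemand_unitDemandOf {w : Fin m → ℝ} (hw : ∀ e, 0 ≤ w e) :
    IsUnitDemand (unitDemandOf w) := by
  refine ⟨fun e => by simpa [unitDemandOf] using hw e, by simp [unitDemandOf], fun S hS => ?_⟩
  simp [unitDemandOf, hS]

theorem le_unitDemandOf {w : Fin m → ℝ} {S : Finset (Fin m)} {e : Fin m} (he : e ∈ S) :
    w e ≤ unitDemandOf w S := by
  have hS : S.Nonempty := ⟨e, he⟩
  simpa only [unitDemandOf, hS, dif_pos] using Finset.le_sup' w he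

theorem exists_le_of_le_unitDemandOf {w : Fin m → ℝ} {S : Finset (Fin m)} {x : ℝ} (hx : 0 < x)
    (h : x ≤ unitDemandOf w S) : ∃ e ∈ S, x ≤ w e := by
  by_cases hS : S.Nonempty
  · simpa [unitDemandOf, hS] using h
  · simp only [unitDemandOf, hS, dif_neg, not_false_eq_true] at h
    linarith

theorem splitsEvenly_one_of_unitDemand [NeZero n] {F : Finset (Allocation n m)}
    (hF : ∀ v ∈ identicalInstances n (IsUnitDemand (m := m)), ∃ A ∈ F, IsMMSAllocation v A) :
    SplitsEvenly F 1 := by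
  intro K hK
  set w : Fin m → ℝ := fun e => if e ∈ K then 1 else 0 with hw
  have hmem : ∀ e, 1 ≤ w e ↔ e ∈ K := fun e => by by_cases he : e ∈ K <;> simp [hw, he]
  obtain ⟨A, hA, hmms⟩ := hF (fun _ => unitDemandOf w)
    ⟨_, isUnitDemand_unitDemandOf fun e => by rw [hw]; positivity, fun _ => rfl⟩
  refine ⟨A, hA, card_inter_bundle_eq_of_le hK fun i => ?_⟩
  have hone : 1 ≤ mms n (unitDemandOf w) := by
    obtain ⟨f, hf⟩ := exists_card_fiber_ge K (fun _ : Fin n => 1) (by simp [hK])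
    refine le_mms f fun j => ?_
    obtain ⟨e, he⟩ := Finset.card_pos.1 (hf j)
    rw [Finset.mem_filter] at he
    exact ((hmem e).2 he.1).trans (le_unitDemandOf (mem_bundle.2 he.2))
  obtain ⟨e, heA, he⟩ := exists_le_of_le_unitDemandOf one_pos (hone.trans (hmms i))
  exact Finset.card_pos.2 ⟨e, Finset.mem_inter.2 ⟨(hmem e).1 he, heA⟩⟩

theorem splitsEvenly_of_binary [NeZero n] {F : Finset (Allocation n m)}
    (hF : ∀ v ∈ identicalInstances n (IsBinary (m := m)), ∃ A ∈ F, IsMMSAllocation v A) (t : ℕ) :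
    SplitsEvenly F t := by
  intro K hK
  obtain ⟨A, hA, hmms⟩ := hF (fun _ => twoValue 1 0 K)
    ⟨_, isBinary_iff_isTwoValued.2 (isTwoValued_twoValue le_rfl zero_le_one K), fun _ => rfl⟩
  refine ⟨A, hA, card_inter_bundle_eq_of_le hK fun i => ?_⟩
  have ht : (t : ℝ) ≤ mms n (twoValue 1 0 K) :=
    le_mms_twoValue le_rfl zero_le_one K (fun _ => t) (fun _ => t) (by simp [hK])
      (by simpa [← hK] using Finset.card_le_univ K) (fun _ => le_rfl) fun _ => by simp
  have hle : (t : ℝ) ≤ twoValue 1 0 K (bundle A i) := ht.trans (hmms i)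
  rw [twoValue_eq] at hle
  simpa using hle

theorem identical_unitDemand_lower : ∃ c : ℝ, 0 < c ∧ ∀ n m : ℕ, 2 ≤ n → 2 * n ≤ m →
    CCAtLeast (identicalInstances n (IsUnitDemand (m := m)))
      (c * (n + Real.logb 2 (Real.logb 2 m))) := by
  refine ⟨1 / 25, by norm_num, fun n m hn hm => ?_⟩
  have : NeZero n := ⟨by omega⟩
  refine CCAtLeast.of_outputs
    ⟨fun _ => unitDemandOf 0, _, isUnitDemand_unitDemandOf fun _ => le_rfl, fun _ => rfl⟩
    fun F hF => ?_
  have hsplit := splitsEvenly_one_of_unitDemand hF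
  have hnF := hsplit.le_twelve_mul_logb_card hn hm
  have hn' : (1 : ℝ) < n := by exact_mod_cast hn
  have hm' : (1 : ℝ) < m := by exact_mod_cast (by omega : 1 < m)
  have hFpos : (F.card : ℝ) ≠ 0 := by
    rintro h0
    rw [h0, Real.logb_zero] at hnF
    linarith
  have hlogn := Real.logb_pos one_lt_two hn'
  have hlogm : Real.logb 2 m ≤ F.card * Real.logb 2 n := by
    rw [← Real.logb_pow]
    exact Real.logb_le_logb_of_le one_lt_two (by linarith)
      (by exact_mod_cast hsplit.le_pow_card hn (by omega))
  have hloglogm : Real.logb 2 (Real.logb 2 m)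
      ≤ Real.logb 2 F.card + Real.logb 2 (Real.logb 2 n) := by
    rw [← Real.logb_mul hFpos hlogn.ne']
    exact Real.logb_le_logb_of_le one_lt_two (Real.logb_pos one_lt_two hm') hlogm
  have hloglogn := (logb_two_le_self hlogn.le).trans (logb_two_le_self (Nat.cast_nonneg n))
  linarith

theorem identical_binary_lower : ∃ c : ℝ, 0 < c ∧ ∀ n m : ℕ, 2 ≤ n → 2 * n ≤ m →
    CCAtLeast (identicalInstances n (IsBinary (m := m)))
      (c * (n * Real.logb 2 ((m : ℝ) / n))) := by
  refine ⟨1 / 44, by norm_num, fun n m hn hm => ?_⟩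
  have : NeZero n := ⟨by omega⟩
  refine CCAtLeast.of_outputs ⟨fun _ => twoValue 1 0 ∅, _, isBinary_iff_isTwoValued.2
    (isTwoValued_twoValue le_rfl zero_le_one ∅), fun _ => rfl⟩ fun F hF => ?_
  have hsplit := splitsEvenly_of_binary hF
  have hF1 := (hsplit 1).one_le_logb_card hn (by omega)
  have hnF := (hsplit 1).le_twelve_mul_logb_card hn hm
  obtain ⟨t, ht⟩ : ∃ t, t = m / (2 * n) := ⟨_, rfl⟩
  have ht1 : 1 ≤ t := by rw [ht, Nat.le_div_iff_mul_le (by omega)]; omega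
  have htm : 2 * (n * t) ≤ m := by rw [ht, ← mul_assoc]; exact Nat.mul_div_le m (2 * n)
  have hmt : m < 2 * n * (t + 1) := by rw [ht]; exact Nat.lt_mul_div_succ m (by omega)
  have htF := (hsplit t).mul_logb_le (by omega) ht1 htm
  have hn' : (2 : ℝ) ≤ n := by exact_mod_cast hn
  have hlogn := logb_two_le_self (Nat.cast_nonneg n)
  have hT : 0 ≤ Real.logb 2 ((t : ℝ) + 1) := Real.logb_nonneg one_lt_two (by simp)
  have hratio : Real.logb 2 ((m : ℝ) / n) ≤ 1 + Real.logb 2 (t + 1) := by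
    have hle : (m : ℝ) / n ≤ 2 * (t + 1) := by
      rw [div_le_iff₀ (by linarith)]
      have : (m : ℝ) ≤ 2 * n * (t + 1) := by exact_mod_cast hmt.le
      linarith
    have hmpos : (0 : ℝ) < m := by exact_mod_cast (by omega : 0 < m)
    have hlog := Real.logb_le_logb_of_le one_lt_two (by positivity) hle
    rwa [Real.logb_mul two_ne_zero (by positivity), Real.logb_self_eq_one one_lt_two] at hlog
  have hmul : (n : ℝ) * Real.logb 2 ((m : ℝ) / n) ≤ n * (1 + Real.logb 2 (t + 1)) := by gcongr
  nlinarith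

end EvenSplitting

theorem choose_mul_choose_le (a b i j : ℕ) :
    a.choose i * b.choose j ≤ (a + b).choose (i + j) := by
  rw [Nat.add_choose_eq]
  exact Finset.single_le_sum (f := fun p : ℕ × ℕ => a.choose p.1 * b.choose p.2)
    (fun _ _ => Nat.zero_le _) (show (i, j) ∈ Finset.HasAntidiagonal.antidiagonal (i + j) by simp)

theorem prod_choose_le {ι : Type*} (S : Finset ι) (s x : ι → ℕ) :
    ∏ i ∈ S, (s i).choose (x i) ≤ (∑ i ∈ S, s i).choose (∑ i ∈ S, x i) := by
  classical
  induction S using Finset.induction_on with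
  | empty => simp
  | insert i S hi ih =>
    rw [Finset.prod_insert hi, Finset.sum_insert hi, Finset.sum_insert hi]
    exact (Nat.mul_le_mul_left _ ih).trans (choose_mul_choose_le _ _ _ _)

theorem choose_mul_pow_le {p q s m : ℕ} (hpq : p ≤ q) (h : q * s ≤ p * m) (k : ℕ) :
    s.choose k * q ^ k ≤ m.choose k * p ^ k := by
  induction k with
  | zero => simp
  | succ k ih =>
    have hk : q * (s - k) ≤ p * (m - k) := by
      rw [Nat.mul_sub, Nat.mul_sub]
      exact tsub_le_tsub h (Nat.mul_le_mul_right k hpq)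
    refine Nat.le_of_mul_le_mul_right (c := k + 1) ?_ (by omega)
    calc s.choose (k + 1) * q ^ (k + 1) * (k + 1)
        = (s.choose (k + 1) * (k + 1)) * q ^ k * q := by ring
      _ = (s.choose k * q ^ k) * (q * (s - k)) := by rw [Nat.choose_succ_right_eq]; ring
      _ ≤ (m.choose k * p ^ k) * (p * (m - k)) := Nat.mul_le_mul ih hk
      _ = (m.choose k * (m - k)) * p ^ k * p := by ring
      _ = m.choose (k + 1) * p ^ (k + 1) * (k + 1) := by rw [← Nat.choose_succ_right_eq]; ring

section TwoValuedLower

variable {n m h E D : ℕ}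

/-- The parameters of the hard 2-valued instances. The item values are `h + 2` and `h`, the target
of every agent is `h * E`, and `n` bundles of size `E` have `D` items more than there are. With
`(h * D + 1) / 2` large items the target is met with a total waste of at most one. -/
structure TightParameters (n m h E D : ℕ) : Prop where
  odd : h % 2 = 1
  add_two_le : h + 2 ≤ E
  le_add_three : E ≤ h + 3
  add_eq : m + D = n * E
  le_two_mul : n ≤ 2 * D
  two_mul_lt : 2 * D < 3 * n

theorem exists_tightParameters (hn : 1 ≤ n) (hm : 2 * n ≤ m) :
    ∃ h E D, TightParameters n m h E D := by
  obtain ⟨E, hE⟩ : ∃ E, E = (2 * m + n + 2 * n - 1) / (2 * n) := ⟨_, rfl⟩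
  have hlo : 2 * m + n ≤ 2 * n * E := by
    have := Nat.lt_mul_div_succ (2 * m + n + 2 * n - 1) (show 0 < 2 * n by omega)
    rw [← hE, mul_add] at this
    omega
  have hhi : 2 * n * E < 2 * m + 3 * n := by
    have := Nat.mul_div_le (2 * m + n + 2 * n - 1) (2 * n)
    rw [← hE] at this
    omega
  have hE3 : 3 ≤ E := by
    by_contra hcon
    have : 2 * n * E ≤ 2 * n * 2 := Nat.mul_le_mul_left _ (by omega)
    omega
  rw [mul_assoc] at hlo hhi
  obtain ⟨h, hodd, hhE, hEh⟩ : ∃ h, h % 2 = 1 ∧ h + 2 ≤ E ∧ E ≤ h + 3 := by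
    rcases Nat.even_or_odd' E with ⟨j, hj | hj⟩
    · exact ⟨E - 3, by omega, by omega, by omega⟩
    · exact ⟨E - 2, by omega, by omega, by omega⟩
  exact ⟨h, E, n * E - m, hodd, hhE, hEh, by omega, by omega, by omega⟩

theorem sum_range_min_two (D j : ℕ) :
    ∑ i ∈ Finset.range j, min 2 (D - 2 * i) = min (2 * j) D := by
  induction j with
  | zero => simp
  | succ j ih => rw [Finset.sum_range_succ, ih]; omega

theorem sum_range_half_mul_min_two (h D j : ℕ) :
    ∑ i ∈ Finset.range j, (h * min 2 (D - 2 * i) + 1) / 2 = (h * min (2 * j) D + 1) / 2 := by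
  induction j with
  | zero => simp
  | succ j ih =>
    rw [Finset.sum_range_succ, ih]
    have hcases : D ≤ 2 * j ∨ D = 2 * j + 1 ∨ 2 * (j + 1) ≤ D := by omega
    rcases hcases with hD | rfl | hD
    · simp [Nat.sub_eq_zero_of_le hD, min_eq_right hD, min_eq_right (show D ≤ 2 * (j + 1) by omega)]
    · rw [min_eq_left (show 2 * j ≤ 2 * j + 1 by omega), show 2 * j + 1 - 2 * j = 1 by omega,
        min_eq_right (show 1 ≤ 2 by omega), min_eq_right (show 2 * j + 1 ≤ 2 * (j + 1) by omega),
        mul_add, mul_left_comm]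
      omega
    · rw [min_eq_left (show 2 * j ≤ D by omega), min_eq_left (show 2 ≤ D - 2 * j by omega),
        min_eq_left hD, mul_left_comm, mul_left_comm h 2 (j + 1), mul_add]
      omega

namespace TightParameters

-- The bundles have sizes `E - 2`, except for at most one of size `E - 1`, until the deficit `D` is
-- exhausted, and size `E` from then on.
theorem le_mms (T : TightParameters n m h E D) {K : Finset (Fin m)}
    (hK : K.card = (h * D + 1) / 2) :
    (h * E : ℝ) ≤ mms n (twoValue (h + 2) h K) := by
  have hD := T.two_mul_lt
  have : NeZero n := ⟨by omega⟩
  set d : Fin n → ℕ := fun i => min 2 (D - 2 * i) with hd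
  have hdsum : ∑ i, d i = D := by
    rw [hd, Fin.sum_univ_eq_sum_range fun i => min 2 (D - 2 * i), sum_range_min_two]
    omega
  have hxsum : ∑ i, (h * d i + 1) / 2 = (h * D + 1) / 2 := by
    rw [hd, Fin.sum_univ_eq_sum_range fun i => (h * min 2 (D - 2 * i) + 1) / 2,
      sum_range_half_mul_min_two, min_eq_right (by omega)]
  have hd2 : ∀ i, d i ≤ 2 := fun i => min_le_left _ _
  have hE := T.add_two_le
  refine le_mms_twoValue (Nat.cast_nonneg h) (by linarith) K (fun i => (h * d i + 1) / 2)
    (fun i => E - d i) (by rw [hxsum, hK]) ?_ (fun i => ?_) fun i => ?_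
  · have hsum : ∑ i, (E - d i) + ∑ i, d i = n * E := by
      rw [← Finset.sum_add_distrib, Finset.sum_congr rfl fun i _ =>
        Nat.sub_add_cancel ((hd2 i).trans (by omega : 2 ≤ E))]
      simp
    have := T.add_eq
    omega
  · have hdi := hd2 i
    interval_cases d i <;> omega
  · have hle : h * E ≤ h * (E - d i) + 2 * ((h * d i + 1) / 2) := by
      have hmul : h * E = h * (E - d i) + h * d i := by
        rw [← mul_add, Nat.sub_add_cancel ((hd2 i).trans (by omega))]
      omega
    rw [add_sub_cancel_left]
    exact_mod_cast hle

variable {s x w : Fin n → ℕ}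

theorem exists_waste (T : TightParameters n m h E D) (hs : ∑ i, s i = m)
    (hx : ∑ i, x i = (h * D + 1) / 2) (htarget : ∀ i, h * E ≤ h * s i + 2 * x i) :
    ∃ w : Fin n → ℕ, (∀ i, h * s i + 2 * x i = h * E + w i) ∧ ∑ i, w i ≤ 1 := by
  choose w hw using fun i => Nat.exists_eq_add_of_le (htarget i)
  refine ⟨w, hw, ?_⟩
  have hsum : ∑ i, (h * s i + 2 * x i) = ∑ i, (h * E + w i) := Finset.sum_congr rfl fun i _ => hw i
  simp only [Finset.sum_add_distrib, ← Finset.mul_sum, hs, hx, Finset.sum_const,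
    Finset.card_univ, Fintype.card_fin, smul_eq_mul] at hsum
  have hmul : h * m + h * D = h * (n * E) := by rw [← mul_add, T.add_eq]
  omega

theorem eq_half (hw : ∀ i, h * s i + 2 * x i = h * E + w i) (hw1 : ∑ i, w i ≤ 1) (i : Fin n) :
    x i = (h * (E - s i) + 1) / 2 := by
  have hwi : w i ≤ 1 :=
    (Finset.single_le_sum (fun _ _ => Nat.zero_le _) (Finset.mem_univ i)).trans hw1
  have hi := hw i
  rcases le_total (s i) E with hsE | hsE
  · have hmul : h * E = h * s i + h * (E - s i) := by rw [← mul_add, Nat.add_sub_cancel' hsE]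
    omega
  · have hmul : h * E ≤ h * s i := Nat.mul_le_mul_left h hsE
    rw [Nat.sub_eq_zero_of_le hsE]
    omega

-- A bundle of size `E - 1` wastes something because `h` is odd.
theorem two_mul_card_short_le (T : TightParameters n m h E D) (hs : ∑ i, s i = m)
    (hw : ∀ i, h * s i + 2 * x i = h * E + w i) (hw1 : ∑ i, w i ≤ 1) :
    2 * (Finset.univ.filter fun i => s i < E).card ≤ D + 1 := by
  have hodd := T.odd
  have hle : ∑ i, (s i + if s i < E then 2 else 0) ≤ ∑ i, (E + w i) := by
    refine Finset.sum_le_sum fun i _ => ?_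
    have hi := hw i
    split_ifs with hsE
    · by_contra! hcon
      obtain rfl : E = s i + 1 := by omega
      rw [mul_add] at hi
      omega
    · obtain ⟨r, hr⟩ := Nat.exists_eq_add_of_le (not_lt.1 hsE)
      have hmul : h * s i = h * E + h * r := by rw [hr, mul_add]
      have : r ≤ h * r := Nat.le_mul_of_pos_left r (by omega)
      omega
  rw [Finset.sum_add_distrib, Finset.sum_add_distrib, hs, ← Finset.sum_filter] at hle
  simp only [Finset.sum_const, smul_eq_mul, Finset.card_univ, Fintype.card_fin] at hle
  have := T.add_eq
  omega

theorem eight_mul_sum_short_le (T : TightParameters n m h E D) (hn : 2 ≤ n) (hs : ∑ i, s i = m)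
    (hshort : 2 * (Finset.univ.filter fun i => s i < E).card ≤ D + 1) :
    8 * ∑ i with s i < E, s i ≤ 7 * m := by
  have hcard := Finset.card_filter_add_card_filter_not (s := Finset.univ) fun i => s i < E
  have hsum := Finset.sum_filter_add_sum_filter_not Finset.univ (fun i => s i < E) s
  rw [Finset.card_univ, Fintype.card_fin] at hcard
  rw [hs] at hsum
  have hlong : (Finset.univ.filter fun i => ¬ s i < E).card * E ≤ ∑ i with ¬ s i < E, s i := by
    rw [← smul_eq_mul]
    exact Finset.card_nsmul_le_sum _ _ _ fun i hi => not_lt.1 (Finset.mem_filter.1 hi).2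
  have hn8 : n ≤ 8 * (Finset.univ.filter fun i => ¬ s i < E).card := by
    have := T.two_mul_lt
    omega
  have hm : n * E ≤ 8 * (Finset.univ.filter fun i => ¬ s i < E).card * E :=
    Nat.mul_le_mul_right E hn8
  have := T.add_eq
  rw [mul_assoc] at hm
  omega

theorem eq_half_and_prod_choose_mul_le (T : TightParameters n m h E D) (hn : 2 ≤ n)
    (hs : ∑ i, s i = m) (hx : ∑ i, x i = (h * D + 1) / 2)
    (htarget : ∀ i, h * E ≤ h * s i + 2 * x i) :
    (∀ i, x i = (h * (E - s i) + 1) / 2) ∧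
      (∏ i, (s i).choose (x i)) * 8 ^ ((h * D + 1) / 2)
        ≤ m.choose ((h * D + 1) / 2) * 7 ^ ((h * D + 1) / 2) := by
  obtain ⟨w, hw, hw1⟩ := T.exists_waste hs hx htarget
  have hhalf : ∀ i, x i = (h * (E - s i) + 1) / 2 := eq_half hw hw1
  have hzero : ∀ i, ¬ s i < E → x i = 0 := fun i hi => by
    simp [hhalf i, Nat.sub_eq_zero_of_le (not_lt.1 hi)]
  have hmass := T.eight_mul_sum_short_le hn hs (T.two_mul_card_short_le hs hw hw1)
  refine ⟨hhalf, le_trans ?_ (choose_mul_pow_le (by norm_num) hmass _)⟩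
  gcongr
  calc ∏ i, (s i).choose (x i) = ∏ i with s i < E, (s i).choose (x i) := by
        refine (Finset.prod_filter_of_ne fun i _ hne => ?_).symm
        by_contra hi
        simp [hzero i hi] at hne
    _ ≤ (∑ i with s i < E, s i).choose (∑ i with s i < E, x i) := prod_choose_le _ _ _
    _ = _ := by
        rw [Finset.sum_filter_of_ne fun i _ hne => by_contra fun hi => hne (hzero i hi), hx]

theorem half_le (T : TightParameters n m h E D) : (h * D + 1) / 2 ≤ m := by
  have h1 : (h + 2) * n ≤ E * n := Nat.mul_le_mul_right n T.add_two_le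
  have h2 : h * (2 * D) ≤ h * (3 * n) := Nat.mul_le_mul_left h T.two_mul_lt.le
  have h3 := T.add_eq
  have h4 := T.two_mul_lt
  rw [mul_comm n E] at h3
  rw [add_mul] at h1
  rw [mul_left_comm, mul_left_comm h 3] at h2
  omega

theorem exists_mem_target_le [NeZero n] (T : TightParameters n m h E D)
    {F : Finset (Allocation n m)}
    (hF : ∀ v ∈ identicalInstances n (IsTwoValued (m := m) (h + 2) h), ∃ A ∈ F,
      IsMMSAllocation v A) {K : Finset (Fin m)} (hK : K.card = (h * D + 1) / 2) :
    ∃ A ∈ F, ∀ i, h * E ≤ h * (bundle A i).card + 2 * (K ∩ bundle A i).card := by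
  obtain ⟨A, hA, hmms⟩ := hF (fun _ => twoValue (h + 2) h K)
    ⟨_, isTwoValued_twoValue (Nat.cast_nonneg h) (by linarith) K, fun _ => rfl⟩
  refine ⟨A, hA, fun i => ?_⟩
  have hle : (h * E : ℝ) ≤ twoValue (h + 2) h K (bundle A i) := (T.le_mms hK).trans (hmms i)
  rw [twoValue_eq, add_sub_cancel_left] at hle
  exact_mod_cast hle

theorem pow_le_card_mul_pow (T : TightParameters n m h E D) (hn : 2 ≤ n)
    {F : Finset (Allocation n m)}
    (hF : ∀ v ∈ identicalInstances n (IsTwoValued (m := m) (h + 2) h), ∃ A ∈ F,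
      IsMMSAllocation v A) :
    8 ^ ((h * D + 1) / 2) ≤ F.card * 7 ^ ((h * D + 1) / 2) := by
  classical
  have : NeZero n := ⟨by omega⟩
  set k := (h * D + 1) / 2
  set F' := F.filter fun A => ∃ K : Finset (Fin m), K.card = k ∧
    ∀ i, h * E ≤ h * (bundle A i).card + 2 * (K ∩ bundle A i).card
  have htight {A : Allocation n m} {K : Finset (Fin m)} (hK : K.card = k) :=
    T.eq_half_and_prod_choose_mul_le hn (sum_card_bundle A)
      ((sum_card_inter_bundle A K).trans hK)
  set Q : Allocation n m → ℕ := fun A =>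
    ∏ i, (bundle A i).card.choose ((h * (E - (bundle A i).card) + 1) / 2)
  have hcover : m.choose k ≤ ∑ A ∈ F', Q A := by
    simpa using choose_le_sum_prod_choose F' Finset.univ
      (fun A i => (h * (E - (bundle A i).card) + 1) / 2) fun K _ hK => by
        obtain ⟨A, hA, hserve⟩ := T.exists_mem_target_le hF hK
        exact ⟨A, Finset.mem_filter.2 ⟨hA, K, hK, hserve⟩, (htight hK hserve).1⟩
  have hQ : ∀ A ∈ F', Q A * 8 ^ k ≤ m.choose k * 7 ^ k := fun A hA => by
    obtain ⟨-, K, hK, hserve⟩ := Finset.mem_filter.1 hA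
    obtain ⟨hhalf, hprod⟩ := htight hK hserve
    simpa only [hhalf] using hprod
  refine Nat.le_of_mul_le_mul_left (c := m.choose k) ?_ (Nat.choose_pos T.half_le)
  calc m.choose k * 8 ^ k ≤ (∑ A ∈ F', Q A) * 8 ^ k := by gcongr
    _ = ∑ A ∈ F', Q A * 8 ^ k := Finset.sum_mul _ _ _
    _ ≤ F'.card * (m.choose k * 7 ^ k) := by simpa using Finset.sum_le_card_nsmul F' _ _ hQ
    _ ≤ F.card * (m.choose k * 7 ^ k) := by gcongr; exact Finset.filter_subset _ _
    _ = m.choose k * (F.card * 7 ^ k) := by ring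

theorem le_sixteen_mul_half (T : TightParameters n m h E D) : m ≤ 16 * ((h * D + 1) / 2) := by
  have hodd := T.odd
  have hE : n * E ≤ n * (4 * h) := Nat.mul_le_mul_left n (T.le_add_three.trans (by omega))
  have hD : h * n ≤ h * (2 * D) := Nat.mul_le_mul_left h T.le_two_mul
  have hm := T.add_eq
  rw [mul_left_comm, mul_comm n h] at hE
  rw [mul_left_comm] at hD
  omega

end TightParameters

theorem le_six_mul_logb_of_pow_le {k N : ℕ} (h : 8 ^ k ≤ N * 7 ^ k) :
    (k : ℝ) ≤ 6 * Real.logb 2 N := by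
  have hN : 0 < N := Nat.pos_of_ne_zero fun h0 => by simp [h0] at h
  have hpow : 2 ^ k ≤ N ^ 6 := by
    refine Nat.le_of_mul_le_mul_right (c := (7 ^ k) ^ 6) ?_ (by positivity)
    calc 2 ^ k * (7 ^ k) ^ 6 = (2 * 7 ^ 6) ^ k := by rw [mul_pow, ← pow_mul, ← pow_mul, mul_comm k]
      _ ≤ (8 ^ 6) ^ k := by gcongr; norm_num
      _ = (8 ^ k) ^ 6 := by rw [← pow_mul, ← pow_mul, mul_comm]
      _ ≤ (N * 7 ^ k) ^ 6 := by gcongr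
      _ = N ^ 6 * (7 ^ k) ^ 6 := mul_pow _ _ _
  have hlog : (k : ℝ) ≤ Real.logb 2 ((N : ℝ) ^ 6) := by
    rw [Real.le_logb_iff_rpow_le one_lt_two (by positivity), Real.rpow_natCast]
    exact_mod_cast hpow
  rw [Real.logb_pow] at hlog
  exact_mod_cast hlog

theorem identical_twoValued_lower : ∃ c : ℝ, 0 < c ∧ ∀ n m : ℕ, 2 ≤ n → 2 * n ≤ m →
    ∃ a b : ℝ, 0 ≤ b ∧ b < a ∧
      CCAtLeast (identicalInstances n (IsTwoValued (m := m) a b)) (c * m) := by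
  refine ⟨1 / 96, by norm_num, fun n m hn hm => ?_⟩
  obtain ⟨h, E, D, T⟩ := exists_tightParameters (by omega) hm
  refine ⟨h + 2, h, Nat.cast_nonneg h, by linarith, CCAtLeast.of_outputs
    ⟨fun _ => twoValue _ _ ∅, _, isTwoValued_twoValue (Nat.cast_nonneg h) (by linarith) ∅,
      fun _ => rfl⟩ fun F hF => ?_⟩
  have hk := le_six_mul_logb_of_pow_le (T.pow_le_card_mul_pow hn hF)
  have hm : (m : ℝ) ≤ 16 * ((h * D + 1) / 2 : ℕ) := by exact_mod_cast T.le_sixteen_mul_half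
  linarith

end TwoValuedLower

theorem identical_twoValued_upper : ∃ c : ℝ, 0 < c ∧ ∀ n m : ℕ, 1 ≤ n → 2 * n ≤ m →
    ∀ a b : ℝ, 0 ≤ b → b < a →
      CCAtMost (identicalInstances n (IsTwoValued (m := m) a b)) (c * m) := by
  refine ⟨1, one_pos, fun n m hn _ a b _ _ => ?_⟩
  have : NeZero n := ⟨by omega⟩
  choose P hP using fun v : ItemValuation m => exists_mms_partition (n := n) v
  obtain ⟨t, ht⟩ := Dialogue.exists_send (ι := Fin n) (α := Finset (Fin m)) 0 (L := m) (by simp)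
    (bigItems a)
  refine CCAtMost.of_dialogue (t.bind fun K => .done (P (twoValue a b K))) ?_ ?_
  · rintro v ⟨u, hu, hv⟩ i
    simp only [Dialogue.run_bind, (ht v).1, Dialogue.run_done, hv]
    rw [← hu.eq_twoValue]
    exact hP u i
  · rintro v -
    simp [(ht v).2]

section TwoValuedUpper

variable {n m : ℕ} {a b : ℝ}

/-- From `m` items, `k` of which have value `a` and the others value `b`, one can form `n` bundles
that are each worth `μ`; the `t`-th bundle has `s t` items, `x t` of them of value `a`. -/
def Divisible (a b : ℝ) (n k m : ℕ) (μ : ℝ) : Prop :=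
  ∃ x s : Fin n → ℕ, ∑ t, x t ≤ k ∧ ∑ t, s t ≤ m ∧ (∀ t, x t ≤ s t) ∧
    ∀ t, μ ≤ b * s t + (a - b) * x t

namespace Divisible

variable {k : ℕ} {μ : ℝ}

theorem anti {μ' : ℝ} (h : Divisible a b n k m μ) (hμ : μ' ≤ μ) : Divisible a b n k m μ' := by
  obtain ⟨x, s, hx, hs, hxs, hv⟩ := h
  exact ⟨x, s, hx, hs, hxs, fun t => hμ.trans (hv t)⟩

-- A largest bundle is removed: if it has fewer than `q` items, so has every other one.
theorem remove_items {q : ℕ} (h : Divisible a b (n + 1) k m μ) (hq : (n + 1) * q ≤ m) :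
    Divisible a b n k (m - q) μ := by
  obtain ⟨x, s, hx, hs, hxs, hv⟩ := h
  obtain ⟨t, -, ht⟩ := Finset.exists_max_image Finset.univ s Finset.univ_nonempty
  rw [Fin.sum_univ_succAbove _ t] at hx hs
  refine ⟨fun j => x (t.succAbove j), fun j => s (t.succAbove j), le_of_add_le_right hx, ?_,
    fun j => hxs _, fun j => hv _⟩
  rcases le_total q (s t) with hqs | hqs
  · dsimp only; omega
  · calc ∑ j, s (t.succAbove j) ≤ n * q := by
          simpa using Finset.sum_le_card_nsmul Finset.univ (fun j => s (t.succAbove j)) q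
            fun j _ => (ht _ (Finset.mem_univ _)).trans hqs
      _ ≤ m - q := by rw [add_mul] at hq; omega

theorem exists_small_bundle (h : Divisible a b (n + 1) k m μ) :
    ∃ p q : ℕ, p ≤ k ∧ p ≤ q ∧ (n + 1) * q ≤ m ∧ μ ≤ b * q + (a - b) * p ∧
      Divisible a b n (k - p) (m - q) μ := by
  obtain ⟨x, s, hx, hs, hxs, hv⟩ := h
  obtain ⟨t, -, ht⟩ := Finset.exists_min_image Finset.univ s Finset.univ_nonempty
  have hq : (n + 1) * s t ≤ m := by
    refine le_trans ?_ hs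
    simpa using Finset.card_nsmul_le_sum Finset.univ s (s t) fun j _ => ht j (Finset.mem_univ j)
  rw [Fin.sum_univ_succAbove _ t] at hx hs
  refine ⟨x t, s t, by omega, hxs t, hq, hv t, fun j => x (t.succAbove j),
    fun j => s (t.succAbove j), ?_, ?_, fun j => hxs _, fun j => hv _⟩ <;> dsimp only <;> omega

end Divisible

theorem divisible_mms [NeZero n] (K : Finset (Fin m)) :
    Divisible a b n K.card m (mms n (twoValue a b K)) := by
  obtain ⟨P, hP⟩ := exists_mms_partition (n := n) (twoValue a b K)
  exact ⟨fun t => (K ∩ bundle P t).card, fun t => (bundle P t).card,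
    (sum_card_inter_bundle P K).le, (sum_card_bundle P).le,
    fun t => Finset.card_le_card Finset.inter_subset_right, fun t => twoValue_eq a b K _ ▸ hP t⟩

theorem sum_Iic_last (f : Fin (n + 1) → ℕ) : ∑ j ∈ Finset.Iic (Fin.last n), f j = ∑ j, f j := by
  rw [← Fin.top_eq_last, Finset.Iic_top]

theorem sum_Iic_castSucc (f : Fin (n + 1) → ℕ) (i : Fin n) :
    ∑ j ∈ Finset.Iic i.castSucc, f j = ∑ j ∈ Finset.Iic i, f j.castSucc := by
  simp [← Fin.map_castSuccEmb_Iic]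

-- The agent with the most large items receives a bundle with as few items as possible; the other
-- agents can still divide what is left because their own smallest bundles are not larger.
theorem exists_ordered_bundles {k : Fin n → ℕ} {μ : Fin n → ℝ} (hk : Monotone k)
    (hμ : Monotone μ) (h : ∀ i, Divisible a b n (k i) m (μ i)) :
    ∃ x s : Fin n → ℕ, (∀ i, ∑ j ∈ Finset.Iic i, x j ≤ k i) ∧ ∑ t, s t ≤ m ∧
      (∀ t, x t ≤ s t) ∧ ∀ i, μ i ≤ b * s i + (a - b) * x i := by
  induction n generalizing m with
  | zero => exact ⟨Fin.elim0, Fin.elim0, fun i => i.elim0, by simp, fun i => i.elim0,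
      fun i => i.elim0⟩
  | succ n ih =>
    obtain ⟨p, q, hpk, hpq, hq, hv, hrest⟩ := (h (Fin.last n)).exists_small_bundle
    obtain ⟨x, s, hx, hs, hxs, hxv⟩ := ih (m := m - q)
      (k := fun i => min (k i.castSucc) (k (Fin.last n) - p)) (μ := fun i => μ i.castSucc)
      (fun i j hij => min_le_min_right _ (hk (Fin.castSucc_le_castSucc_iff.2 hij)))
      (fun i j hij => hμ (Fin.castSucc_le_castSucc_iff.2 hij)) fun i => by
        rcases min_choice (k i.castSucc) (k (Fin.last n) - p) with hmin | hmin <;> rw [hmin]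
        exacts [(h i.castSucc).remove_items hq, hrest.anti (hμ (Fin.le_last _))]
    have hxk : ∑ j, x j ≤ k (Fin.last n) - p := by
      rcases n with _ | n
      · simp
      · simpa only [sum_Iic_last] using (hx (Fin.last n)).trans (min_le_right _ _)
    have hqm : q ≤ m := (Nat.le_mul_of_pos_left q n.succ_pos).trans hq
    refine ⟨Fin.snoc x p, Fin.snoc s q, fun i => ?_, ?_, fun i => ?_, fun i => ?_⟩
    · refine Fin.lastCases ?_ (fun i => ?_) i
      · simp only [sum_Iic_last, Fin.sum_univ_castSucc, Fin.snoc_castSucc, Fin.snoc_last]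
        omega
      · simpa [sum_Iic_castSucc] using (hx i).trans (min_le_left _ _)
    · simp only [Fin.sum_univ_castSucc, Fin.snoc_castSucc, Fin.snoc_last]
      omega
    · refine Fin.lastCases ?_ (fun i => ?_) i
      · simpa using hpq
      · simpa using hxs i
    · refine Fin.lastCases ?_ (fun i => ?_) i
      · simpa using hv
      · simpa using hxv i

theorem exists_capped_bundle {x s r : ℕ} {μ : ℝ} (hxs : x ≤ s)
    (h : μ ≤ b * s + (a - b) * x) (hr : μ ≤ a * r) :
    ∃ y t : ℕ, y ≤ x ∧ y ≤ r ∧ t ≤ s ∧ y ≤ t ∧ μ ≤ b * t + (a - b) * y := by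
  rcases le_total x r with hxr | hrx
  · exact ⟨x, s, le_rfl, hxr, le_rfl, hxs, h⟩
  · exact ⟨r, r, hrx, le_rfl, hrx.trans hxs, le_rfl, hr.trans_eq (by ring)⟩

theorem exists_schedule [NeZero n] (hb : 0 ≤ b) (hab : b ≤ a) {r : ℕ} (hr : m ≤ n * r)
    {k : Fin n → ℕ} (hk : ∀ i, k i ≤ m) :
    ∃ (σ : Equiv.Perm (Fin n)) (x s : Fin n → ℕ),
      (∀ i, ∑ j ∈ Finset.Iic i, x j ≤ k (σ i)) ∧ ∑ i, s i ≤ m ∧ (∀ i, x i ≤ s i) ∧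
      (∀ i, x i ≤ r) ∧ ∀ i (K : Finset (Fin m)), K.card = k (σ i) →
        mms n (twoValue a b K) ≤ b * s i + (a - b) * x i := by
  choose K _ hK using fun i => Finset.exists_subset_card_eq
    (s := (Finset.univ : Finset (Fin m))) (n := k i) (by simpa using hk i)
  set σ := Tuple.sort k
  have hmono : Monotone fun i => k (σ i) := Tuple.monotone_sort k
  obtain ⟨x, s, hx, hs, hxs, hv⟩ := exists_ordered_bundles (a := a) (b := b) (m := m) hmono
    (μ := fun i => mms n (twoValue a b (K (σ i))))
    (fun i j hij => mms_twoValue_mono hb hab (by simpa only [hK] using hmono hij))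
    fun i => hK (σ i) ▸ divisible_mms (K (σ i))
  choose y t hyx hyr hts hyt hμ using fun i =>
    exists_capped_bundle (hxs i) (hv i) (mms_twoValue_le hb hab hr (K (σ i)))
  refine ⟨σ, y, t, fun i => (Finset.sum_le_sum fun j _ => hyx j).trans (hx i),
    (Finset.sum_le_sum fun i _ => hts i).trans hs, hyt, hyr, fun i K' hK' => ?_⟩
  exact (mms_twoValue_mono hb hab (hK'.trans (hK (σ i)).symm).le).trans (hμ i)

theorem exists_subset_dialogue {ι X α : Type*} [DecidableEq ι] [Finite α] {L r k : ℕ}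
    (hL : Nat.card {T : Finset α // T.card ≤ r} ≤ 2 ^ L) (hk : k ≤ r) (i : ι)
    (K : X → Finset α) :
    ∃ t : Dialogue ι X (Finset α), ∀ v, t.cost v = Pi.single i L ∧
      (k ≤ (K (v i)).card → t.run v ⊆ K (v i) ∧ (t.run v).card = k) := by
  have : Nonempty {T : Finset α // T.card ≤ r} := ⟨⟨∅, by simp⟩⟩
  have hpick : ∀ S : Finset α, ∃ T : {T : Finset α // T.card ≤ r},
      k ≤ S.card → T.1 ⊆ S ∧ T.1.card = k := fun S => by
    by_cases h : k ≤ S.card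
    · obtain ⟨T, hT, hTk⟩ := Finset.exists_subset_card_eq h
      exact ⟨⟨T, hTk.trans_le hk⟩, fun _ => ⟨hT, hTk⟩⟩
    · exact ⟨⟨∅, by simp⟩, fun h' => absurd h' h⟩
  choose pick hpick using hpick
  obtain ⟨t, ht⟩ := Dialogue.exists_send i hL fun u => pick (K u)
  exact ⟨t.bind fun T => .done T.1, fun v => by simpa [ht] using hpick (K (v i))⟩

theorem exists_picking_dialogue {ι X α : Type*} [DecidableEq ι] [Finite α] {L r : ℕ}
    (hL : Nat.card {T : Finset α // T.card ≤ r} ≤ 2 ^ L) (K : X → Finset α) (σ : Fin n → ι)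
    {x : Fin n → ℕ} (hxr : ∀ i, x i ≤ r) :
    ∃ t : Dialogue ι X (Fin n → Finset α), ∀ v, t.cost v = ∑ i, Pi.single (σ i) L ∧
      ((∀ i, ∑ j ∈ Finset.Iic i, x j ≤ (K (v (σ i))).card) →
        ∀ i, t.run v i ⊆ K (v (σ i)) ∧ (t.run v i).card = x i ∧
          ∀ j < i, Disjoint (t.run v i) (t.run v j)) := by
  classical
  induction n with
  | zero => exact ⟨.done Fin.elim0, fun v => ⟨by simp, fun _ i => i.elim0⟩⟩
  | succ n ih =>
    obtain ⟨t, ht⟩ := ih (fun i => σ i.castSucc) (x := fun i => x i.castSucc) fun i => hxr _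
    choose last hlast using fun g : Fin n → Finset α =>
      exists_subset_dialogue hL (hxr (Fin.last n)) (σ (Fin.last n))
        fun u => K u \ Finset.univ.biUnion g
    refine ⟨t.bind fun g => (last g).bind fun S => .done (Fin.snoc g S), fun v => ⟨?_, ?_⟩⟩
    · simp [(ht v).1, (hlast _ v).1, Fin.sum_univ_castSucc]
    intro hroom
    have hg := (ht v).2 fun i => (sum_Iic_castSucc x i).symm.trans_le (hroom i.castSucc)
    simp only [Dialogue.run_bind, Dialogue.run_done]
    set g := t.run v
    obtain ⟨hS, hSx⟩ := (hlast g v).2 <| by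
      have hcard : (Finset.univ.biUnion g).card ≤ ∑ i : Fin n, x i.castSucc :=
        Finset.card_biUnion_le.trans_eq (Finset.sum_congr rfl fun i _ => (hg i).2.1)
      have hsum := hroom (Fin.last n)
      rw [sum_Iic_last, Fin.sum_univ_castSucc] at hsum
      have := Finset.le_card_sdiff (Finset.univ.biUnion g) (K (v (σ (Fin.last n))))
      omega
    have hdisj : ∀ j, Disjoint ((last g).run v) (g j) := fun j => Finset.disjoint_of_subset_left hS
      (Finset.sdiff_disjoint.mono_right (Finset.subset_biUnion_of_mem g (Finset.mem_univ j)))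
    intro i
    have hlt (j) (hj : j < i) : ∃ j' : Fin n, j'.castSucc = j :=
      Fin.exists_castSucc_eq.2 (hj.trans_le (Fin.le_last i)).ne
    induction i using Fin.lastCases with
    | last =>
      simp only [Fin.snoc_last]
      refine ⟨hS.trans Finset.sdiff_subset, hSx, fun j hj => ?_⟩
      obtain ⟨j, rfl⟩ := hlt j hj
      simpa using hdisj j
    | cast i =>
      simp only [Fin.snoc_castSucc]
      refine ⟨(hg i).1, (hg i).2.1, fun j hj => ?_⟩
      obtain ⟨j, rfl⟩ := hlt j hj
      simpa using (hg i).2.2 j (Fin.castSucc_lt_castSucc_iff.1 hj)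

theorem exists_scheduled_dialogue [NeZero n] (hb : 0 ≤ b) (hab : b ≤ a) {r L : ℕ}
    (hr : m ≤ n * r) (hL : Nat.card {T : Finset (Fin m) // T.card ≤ r} ≤ 2 ^ L)
    {k : Fin n → ℕ} (hk : ∀ i, k i ≤ m) :
    ∃ t : Dialogue (Fin n) (ItemValuation m) (Allocation n m), ∀ v, t.cost v = (fun _ => L) ∧
      (v ∈ instances n (IsTwoValued (m := m) a b) → (∀ i, (bigItems a (v i)).card = k i) →
        IsMMSAllocation v (t.run v)) := by
  obtain ⟨σ, x, s, hx, hs, hxs, hxr, hmms⟩ := exists_schedule hb hab hr hk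
  obtain ⟨t, ht⟩ := exists_picking_dialogue hL (bigItems a) σ hxr
  have hextend : ∀ g : Fin n → Finset (Fin m), ∃ A : Allocation n m,
      (∀ i, (g i).card = x i ∧ ∀ j < i, Disjoint (g i) (g j)) →
        ∀ i, g i ⊆ bundle A i ∧ s i ≤ (bundle A i).card := fun g => by
    by_cases h : ∀ i, (g i).card = x i ∧ ∀ j < i, Disjoint (g i) (g j)
    · obtain ⟨A, hA⟩ := exists_allocation_extending g
        (fun i j hij => hij.lt_or_gt.elim (fun hlt => ((h j).2 i hlt).symm) ((h i).2 j)) s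
        (fun i => (h i).1.trans_le (hxs i)) hs
      exact ⟨A, fun _ => hA⟩
    · exact ⟨fun _ => 0, fun h' => absurd h' h⟩
  choose extend hextend using hextend
  refine ⟨t.bind fun g => .done fun e => σ (extend g e), fun v => ⟨?_, fun hv hvk => ?_⟩⟩
  · simp only [Dialogue.cost_bind, Dialogue.cost_done, add_zero, (ht v).1]
    rw [Equiv.sum_comp σ fun i => (Pi.single i L : Fin n → ℕ), Finset.univ_sum_single]
  have hpicked := (ht v).2 fun i => (hx i).trans_eq (hvk (σ i)).symm
  simp only [Dialogue.run_bind, Dialogue.run_done]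
  refine σ.forall_congr_right.1 fun i => ?_
  have hA := hextend (t.run v) (fun i => (hpicked i).2) i
  have hbundle : bundle (fun e => σ (extend (t.run v) e)) (σ i) = bundle (extend (t.run v)) i := by
    ext e; simp
  rw [hbundle, (hv (σ i)).eq_twoValue]
  refine (hmms i _ (hvk (σ i))).trans ?_
  rw [twoValue_eq, ← (hpicked i).2.1]
  gcongr
  · exact hA.2
  · exact Finset.subset_inter (hpicked i).1 hA.1

theorem exists_twoValued_dialogue [NeZero n] (hb : 0 ≤ b) (hab : b ≤ a) {r L₁ L₂ : ℕ}
    (hr : m ≤ n * r) (h₁ : m + 1 ≤ 2 ^ L₁)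
    (h₂ : Nat.card {T : Finset (Fin m) // T.card ≤ r} ≤ 2 ^ L₂) :
    ∃ t : Dialogue (Fin n) (ItemValuation m) (Allocation n m),
      ∀ v ∈ instances n (IsTwoValued (m := m) a b),
        IsMMSAllocation v (t.run v) ∧ t.cost v = fun _ => L₁ + L₂ := by
  obtain ⟨count, hcount⟩ := Dialogue.exists_broadcast (ι := Fin n) (α := Fin (m + 1))
    (by simpa using h₁) fun u => Fin.ofNat (m + 1) (bigItems a u).card
  choose t ht using fun k : Fin n → Fin (m + 1) =>
    exists_scheduled_dialogue hb hab hr h₂ fun i => Nat.le_of_lt_succ (k i).isLt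
  refine ⟨count.bind t, fun v hv => ⟨?_, ?_⟩⟩
  · rw [Dialogue.run_bind]
    refine (ht _ v).2 hv fun i => ?_
    have hle : (bigItems a (v i)).card ≤ m := by
      simpa using Finset.card_le_univ (bigItems a (v i))
    simp [(hcount v).1, Nat.mod_eq_of_lt (Nat.lt_succ_of_le hle)]
  · rw [Dialogue.cost_bind, (hcount v).2, (ht _ v).1]
    rfl

theorem clog_two_le {N : ℕ} (hN : 1 ≤ N) : (Nat.clog 2 N : ℝ) ≤ Real.logb 2 N + 1 := by
  rw [← Real.natCeil_logb_natCast]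
  exact (Nat.ceil_lt_add_one (Real.logb_nonneg one_lt_two (by exact_mod_cast hN))).le

theorem card_small_subsets_mul_le {r : ℕ} (hn : 0 < n) :
    Nat.card {T : Finset (Fin m) // T.card ≤ r} * n ^ (m - r) ≤ (n + 1) ^ m := by
  rw [Nat.card_eq_fintype_card, Fintype.card_subtype, ← smul_eq_mul]
  calc _ ≤ ∑ T : Finset (Fin m) with T.card ≤ r, n ^ (m - T.card) :=
        Finset.card_nsmul_le_sum _ _ _ fun T hT =>
          Nat.pow_le_pow_right hn (Nat.sub_le_sub_left (Finset.mem_filter.1 hT).2 m)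
    _ ≤ ∑ T : Finset (Fin m), n ^ (m - T.card) :=
        Finset.sum_le_sum_of_subset (Finset.filter_subset _ _)
    _ = (n + 1) ^ m := by
        simpa [add_comm] using Fintype.sum_pow_mul_eq_add_pow (Fin m) (1 : ℕ) n

theorem logb_card_small_subsets_le {r : ℕ} (hn : 0 < n) (hrm : r ≤ m) :
    Real.logb 2 (Nat.card {T : Finset (Fin m) // T.card ≤ r})
      ≤ r * Real.logb 2 n + 2 * (m / n) := by
  have hN : 0 < Nat.card {T : Finset (Fin m) // T.card ≤ r} :=
    Nat.card_pos_iff.2 ⟨⟨⟨∅, by simp⟩⟩, inferInstance⟩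
  have hn0 : (0 : ℝ) < n := by exact_mod_cast hn
  have hle : (Nat.card {T : Finset (Fin m) // T.card ≤ r} : ℝ) ≤ n ^ r * (1 + 1 / n) ^ m := by
    refine le_of_mul_le_mul_right ?_ (pow_pos hn0 (m - r))
    calc _ ≤ ((n : ℝ) + 1) ^ m := by exact_mod_cast card_small_subsets_mul_le hn
      _ = (n * (1 + 1 / n)) ^ m := by field_simp
      _ = n ^ r * (1 + 1 / n) ^ m * n ^ (m - r) := by
          rw [mul_pow, ← pow_mul_pow_sub _ hrm]; ring
  have hlog : Real.logb 2 (1 + 1 / (n : ℝ)) ≤ 2 * (1 / n) := by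
    have hinv : 0 < 1 / (n : ℝ) := one_div_pos.2 hn0
    have hlog1 := Real.log_le_sub_one_of_pos (show 0 < 1 + 1 / (n : ℝ) by linarith)
    have hlog2 := Real.log_two_gt_d9
    rw [Real.logb, div_le_iff₀ (by linarith)]
    nlinarith
  calc _ ≤ Real.logb 2 ((n : ℝ) ^ r * (1 + 1 / n) ^ m) :=
        Real.logb_le_logb_of_le one_lt_two (by exact_mod_cast hN) hle
    _ = r * Real.logb 2 n + m * Real.logb 2 (1 + 1 / n) := by
        rw [Real.logb_mul (by positivity) (by positivity), Real.logb_pow, Real.logb_pow]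
    _ ≤ r * Real.logb 2 n + m * (2 * (1 / n)) := by gcongr
    _ = r * Real.logb 2 n + 2 * (m / n) := by ring

theorem exists_word_lengths (hn : 2 ≤ n) (hm : 2 * n ≤ m) :
    ∃ r L₁ L₂ : ℕ, m ≤ n * r ∧ m + 1 ≤ 2 ^ L₁ ∧
      Nat.card {T : Finset (Fin m) // T.card ≤ r} ≤ 2 ^ L₂ ∧
      ((L₁ + L₂ : ℕ) : ℝ) ≤ 7 * ((m : ℝ) / n * Real.logb 2 n) := by
  have hn2 : (2 : ℝ) ≤ n := by exact_mod_cast hn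
  have hn0 : (0 : ℝ) < n := by linarith
  obtain ⟨r, hr⟩ : ∃ r, r = ⌈(m : ℝ) / n⌉₊ := ⟨_, rfl⟩
  have hmr : m ≤ n * r := by
    have := Nat.le_ceil ((m : ℝ) / n)
    rw [← hr, div_le_iff₀' hn0] at this
    exact_mod_cast this
  have hrm : r ≤ m := hr ▸ Nat.ceil_le.2 (div_le_self (Nat.cast_nonneg m) (by linarith))
  refine ⟨r, Nat.clog 2 (m + 1), _, hmr, Nat.le_pow_clog one_lt_two _,
    Nat.le_pow_clog one_lt_two _, ?_⟩
  have hrρ : (r : ℝ) ≤ m / n + 1 := hr ▸ (Nat.ceil_lt_add_one (by positivity)).le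
  have hmρ : (m : ℝ) = n * (m / n) := by field_simp
  have hρ2 : 2 ≤ (m : ℝ) / n := by rw [le_div_iff₀ hn0]; exact_mod_cast hm
  set ρ : ℝ := m / n
  set l : ℝ := Real.logb 2 n
  have hl1 : 1 ≤ l := one_le_logb_two hn2
  have hcount : (Nat.clog 2 (m + 1) : ℝ) ≤ l + ρ + 2 := by
    refine (clog_two_le (by omega)).trans ?_
    have hlog : Real.logb 2 ((m + 1 : ℕ) : ℝ) ≤ Real.logb 2 (2 * (n * ρ)) := by
      refine Real.logb_le_logb_of_le one_lt_two (by positivity) ?_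
      push_cast
      nlinarith
    rw [Real.logb_mul (by positivity) (by positivity), Real.logb_mul (by positivity)
      (by positivity), Real.logb_self_eq_one one_lt_two] at hlog
    linarith [logb_two_le_self (show 0 ≤ ρ by linarith)]
  have hpick : (Nat.clog 2 (Nat.card {T : Finset (Fin m) // T.card ≤ r}) : ℝ)
      ≤ r * l + 2 * ρ + 1 := by
    refine (clog_two_le (Nat.card_pos_iff.2 ⟨⟨⟨∅, by simp⟩⟩, inferInstance⟩)).trans ?_
    linarith [logb_card_small_subsets_le (show 0 < n by omega) hrm]
  push_cast
  nlinarith [mul_le_mul_of_nonneg_right hrρ (show 0 ≤ l by linarith)]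

theorem twoValued_upper : ∃ c : ℝ, 0 < c ∧ ∀ n m : ℕ, 1 ≤ n → 2 * n ≤ m →
    ∀ a b : ℝ, 0 ≤ b → b < a →
      ∃ P : Protocol n m, P.SolvesMMS (instances n (IsTwoValued a b)) ∧
        ∀ v ∈ instances n (IsTwoValued (m := m) a b),
          (P.bits v : ℝ) ≤ c * (m * Real.logb 2 n) ∧
          ∀ i, (P.agentBits v i : ℝ) ≤ c * ((m : ℝ) / n * Real.logb 2 n) := by
  refine ⟨7, by norm_num, fun n m hn hm a b hb hab => ?_⟩
  rcases hn.eq_or_lt with rfl | hn2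
  · exact ⟨.output fun _ => 0, fun v _ => isMMSAllocation_one v _, fun v _ =>
      ⟨by simp [Protocol.bits, Protocol.transcript],
        fun i => by simp [Protocol.agentBits, Protocol.transcript]⟩⟩
  have : NeZero n := ⟨by omega⟩
  obtain ⟨r, L₁, L₂, hr, h₁, h₂, hL⟩ := exists_word_lengths hn2 hm
  obtain ⟨t, ht⟩ := exists_twoValued_dialogue hb hab.le hr h₁ h₂
  refine ⟨t.toProtocol, fun v hv => ?_, fun v hv => ⟨?_, fun i => ?_⟩⟩
  · rw [Dialogue.result_toProtocol]
    exact (ht v hv).1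
  · rw [Dialogue.bits_toProtocol, (ht v hv).2]
    calc ((∑ _i : Fin n, (L₁ + L₂) : ℕ) : ℝ) = n * (L₁ + L₂ : ℕ) := by simp
      _ ≤ n * (7 * ((m : ℝ) / n * Real.logb 2 n)) := by gcongr
      _ = 7 * (m * Real.logb 2 n) := by field_simp
  · rwa [Dialogue.agentBits_toProtocol, (ht v hv).2]

end TwoValuedUpper

section BinaryUpper

theorem exists_cut {m : ℕ} (T : Finset (Fin m)) {c : ℕ} (hc : c ≤ T.card) :
    ∃ p : Fin (m + 1), {e ∈ T | e.val < p.val}.card = c := by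
  obtain ⟨T', hT', hcard, hlow⟩ := exists_top_subset T OrderDual.toDual hc
  have hp : T'.sup (fun e => e.val + 1) ≤ m := Finset.sup_le fun e _ => e.isLt
  refine ⟨⟨_, Nat.lt_succ_of_le hp⟩, ?_⟩
  rw [← hcard]
  congr 1
  ext e
  simp only [Finset.mem_filter, Finset.lt_sup_iff]
  constructor
  · rintro ⟨heT, e', he', hlt⟩
    by_contra he
    have hle : e' ≤ e := hlow e' he' e (Finset.mem_sdiff.2 ⟨heT, he⟩)
    exact he (le_antisymm (Fin.le_def.2 (Nat.lt_succ_iff.1 hlt)) hle ▸ he')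
  · exact fun he => ⟨hT' he, e, he, Nat.lt_succ_self _⟩

theorem exists_early_group {ι : Type*} [DecidableEq ι] (G : Finset ι) (c : ι → ℕ) {g : ℕ}
    (hg : g ≤ G.card) :
    ∃ G₁ ⊆ G, ∃ p, G₁.card = g ∧ (∀ i ∈ G₁, c i ≤ p) ∧ ∀ i ∈ G \ G₁, p ≤ c i := by
  obtain ⟨G₁, hG₁, hcard, hlow⟩ := exists_top_subset G (fun i => OrderDual.toDual (c i)) hg
  exact ⟨G₁, hG₁, G₁.sup c, hcard, fun i hi => Finset.le_sup hi,
    fun i hi => Finset.sup_le fun j hj => hlow j hj i hi⟩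

variable {ι X : Type*} [DecidableEq ι] {m : ℕ}

/-- If every agent `i` of `G` likes at least `t i` items of `I` per member of `G`, then `A` gives
her `t i` of the items she likes. This is the goal of dividing `I` among `G`. -/
def SharesFairly (T : ι → Finset (Fin m)) (t : ι → ℕ) (G : Finset ι) (I : Finset (Fin m))
    (A : Fin m → ι) : Prop :=
  (∀ i ∈ G, t i * G.card ≤ (T i ∩ I).card) → ∀ i ∈ G, t i ≤ {e ∈ T i ∩ I | A e = i}.card

theorem sharesFairly_const {T : ι → Finset (Fin m)} {t : ι → ℕ} {G : Finset ι}
    {I : Finset (Fin m)} {i : ι} (hG : G ⊆ {i}) : SharesFairly T t G I fun _ => i := by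
  intro h j hj
  obtain rfl := Finset.mem_singleton.1 (hG hj)
  have hcard : 1 ≤ G.card := Finset.card_pos.2 ⟨j, hj⟩
  simpa using (Nat.le_mul_of_pos_right _ hcard).trans (h j hj)

theorem SharesFairly.glue {T : ι → Finset (Fin m)} {t : ι → ℕ} {G G₁ : Finset ι}
    {I : Finset (Fin m)} {A₁ A₂ : Fin m → ι} {c : ι → ℕ} {p : ℕ} (hG : G₁ ⊆ G)
    (hcut : ∀ i ∈ G, t i * G₁.card ≤ (T i ∩ I).card →
      {e ∈ T i ∩ I | e.val < c i}.card = t i * G₁.card)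
    (hearly : ∀ i ∈ G₁, c i ≤ p) (hlate : ∀ i ∈ G \ G₁, p ≤ c i)
    (h₁ : SharesFairly T t G₁ {e ∈ I | e.val < p} A₁)
    (h₂ : SharesFairly T t (G \ G₁) {e ∈ I | ¬ e.val < p} A₂) :
    SharesFairly T t G I fun e => if e.val < p then A₁ e else A₂ e := by
  intro hshare i hi
  have hc : ∀ i ∈ G, {e ∈ T i ∩ I | e.val < c i}.card = t i * G₁.card := fun i hi =>
    hcut i hi ((Nat.mul_le_mul_left _ (Finset.card_le_card hG)).trans (hshare i hi))
  by_cases hi₁ : i ∈ G₁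
  · refine (h₁ (fun j hj => ?_) i hi₁).trans (Finset.card_le_card fun e he => ?_)
    · rw [← hc j (hG hj), Finset.inter_filter]
      exact Finset.card_le_card
        (Finset.monotone_filter_right _ fun e _ he => he.trans_le (hearly j hj))
    · simp only [Finset.mem_filter, Finset.mem_inter] at he ⊢
      simp [he]
  · refine (h₂ (fun j hj => ?_) i (Finset.mem_sdiff.2 ⟨hi, hi₁⟩)).trans
      (Finset.card_le_card fun e he => ?_)
    · have hjG := (Finset.mem_sdiff.1 hj).1
      have hbefore : {e ∈ T j ∩ I | e.val < p}.card ≤ t j * G₁.card := by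
        rw [← hc j hjG]
        exact Finset.card_le_card
          (Finset.monotone_filter_right _ fun e _ he => he.trans_le (hlate j hj))
      have hsplit := Finset.card_filter_add_card_filter_not (s := T j ∩ I) fun e => e.val < p
      have hall := hshare j hjG
      rw [← Finset.card_sdiff_add_card_eq_card hG, mul_add] at hall
      rw [Finset.inter_filter]
      omega
    · simp only [Finset.mem_filter, Finset.mem_inter] at he ⊢
      simp [he]

/-
Divide and choose: every agent announces a cut that leaves her the share of half of the group on
the left; the half with the earliest cuts continues on the left of the median cut, the others on
its right.
-/
theorem exists_halving_dialogue [Nonempty ι] (S : X → Finset (Fin m)) (t : X → ℕ) {L : ℕ}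
    (hL : m + 1 ≤ 2 ^ L) (d : ℕ) (G : Finset ι) (I : Finset (Fin m)) (hd : G.card ≤ 2 ^ d) :
    ∃ D : Dialogue ι X (Fin m → ι), ∀ v, (∀ i, D.cost v i ≤ if i ∈ G then d * L else 0) ∧
      SharesFairly (S ∘ v) (t ∘ v) G I (D.run v) := by
  induction d generalizing G I with
  | zero =>
    obtain ⟨i, hi⟩ := Finset.card_le_one_iff_subset_singleton.1 hd
    exact ⟨.done fun _ => i, fun v => ⟨by simp, sharesFairly_const hi⟩⟩
  | succ d ih =>
    rw [pow_succ] at hd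
    obtain ⟨g, hg⟩ : ∃ g, g = G.card / 2 := ⟨_, rfl⟩
    have hexists : ∀ u : X, ∃ p : Fin (m + 1), t u * g ≤ (S u ∩ I).card →
        {e ∈ S u ∩ I | e.val < p.val}.card = t u * g := fun u => by
      by_cases h : t u * g ≤ (S u ∩ I).card
      · exact (exists_cut _ h).imp fun p hp _ => hp
      · exact ⟨0, fun h' => absurd h' h⟩
    choose cut hcut using hexists
    choose send hsend using fun i : ι =>
      Dialogue.exists_send (α := Fin (m + 1)) i (by simpa using hL) cut
    obtain ⟨D₀, hD₀⟩ := Dialogue.exists_gather send G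
    choose G₁ hG₁ p hcard hearly hlate using fun c : ι → Fin (m + 1) =>
      exists_early_group G (fun i => c i) (by omega : g ≤ G.card)
    choose D₁ hD₁ using fun c => ih (G₁ c) {e ∈ I | e.val < p c} (by rw [hcard]; omega)
    choose D₂ hD₂ using fun c => ih (G \ G₁ c) {e ∈ I | ¬ e.val < p c} (by
      rw [Finset.card_sdiff_of_subset (hG₁ c), hcard]; omega)
    refine ⟨D₀.bind fun c => (D₁ c).bind fun A₁ => (D₂ c).bind fun A₂ =>
      .done fun e => if e.val < p c then A₁ e else A₂ e, fun v => ⟨fun i => ?_, ?_⟩⟩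
    · have hcost₁ := (hD₁ (D₀.run v) v).1 i
      have hcost₂ := (hD₂ (D₀.run v) v).1 i
      have hsub := @hG₁ (D₀.run v) i
      simp only [Dialogue.cost_bind, Dialogue.cost_done, Pi.add_apply, (hD₀ v).2,
        Finset.sum_apply, hsend, Finset.sum_pi_single, Finset.mem_sdiff] at hcost₂ ⊢
      rw [add_one_mul]
      split_ifs at * <;> simp_all <;> omega
    · simp only [Dialogue.run_bind, Dialogue.run_done]
      refine SharesFairly.glue (hG₁ _) (fun i hi => ?_) (hearly _) (hlate _) (hD₁ _ v).2 (hD₂ _ v).2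
      rw [hcard, (hD₀ v).1 i hi, (hsend i v).1]
      exact hcut (v i)

variable {n : ℕ} [NeZero n]

theorem mms_binary_le (K : Finset (Fin m)) :
    mms n (twoValue 1 0 K) ≤ (K.card / n : ℕ) := by
  refine mms_le fun P => ?_
  obtain ⟨j, -, hj⟩ : ∃ j ∈ Finset.univ, (K ∩ bundle P j).card ≤ K.card / n := by
    by_contra! h
    have hlt := Finset.card_nsmul_le_sum Finset.univ _ (K.card / n + 1) h
    rw [sum_card_inter_bundle, Finset.card_univ, Fintype.card_fin, smul_eq_mul] at hlt
    exact absurd (Nat.lt_mul_div_succ K.card (NeZero.pos n)) hlt.not_gt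
  refine ⟨j, ?_⟩
  rw [twoValue_eq]
  simpa using hj

theorem binary_upper : ∃ c : ℝ, 0 < c ∧ ∀ n m : ℕ, 1 ≤ n → 2 * n ≤ m →
    CCAtMost (instances n (IsBinary (m := m))) (c * (n * Real.logb 2 m * Real.logb 2 n)) := by
  refine ⟨6, by norm_num, fun n m hn hm => ?_⟩
  rcases hn.eq_or_lt with rfl | hn2
  · exact CCAtMost.one_agent _ (by simp)
  have : NeZero n := ⟨by omega⟩
  obtain ⟨D, hD⟩ := exists_halving_dialogue (ι := Fin n) (bigItems 1)
    (fun u => (bigItems 1 u).card / n) (Nat.le_pow_clog one_lt_two (m + 1)) (Nat.clog 2 n)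
    Finset.univ Finset.univ (by simpa using Nat.le_pow_clog one_lt_two n)
  refine CCAtMost.of_dialogue D (fun v hv i => ?_) fun v _ => ?_
  · have hshare := (hD v).2 (fun i _ => by simpa using Nat.div_mul_le_self _ n) i
      (Finset.mem_univ i)
    rw [(isBinary_iff_isTwoValued.1 (hv i)).eq_twoValue]
    refine (mms_binary_le _).trans ?_
    rw [twoValue_eq]
    simpa [bundle, Finset.inter_filter] using hshare
  · have hlogn : 1 ≤ Real.logb 2 (n : ℝ) := one_le_logb_two (by exact_mod_cast hn2)
    have hlogm : 1 ≤ Real.logb 2 (m : ℝ) :=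
      one_le_logb_two (by exact_mod_cast (by omega : 2 ≤ m))
    have hround : (Nat.clog 2 n : ℝ) ≤ 2 * Real.logb 2 n := by linarith [clog_two_le hn]
    have hword : (Nat.clog 2 (m + 1) : ℝ) ≤ 3 * Real.logb 2 m := by
      have hle : Nat.clog 2 (m + 1) ≤ Nat.clog 2 m + 1 :=
        Nat.clog_le_of_le_pow (by have := Nat.le_pow_clog one_lt_two m; omega)
      have hle' : (Nat.clog 2 (m + 1) : ℝ) ≤ Nat.clog 2 m + 1 := by exact_mod_cast hle
      linarith [clog_two_le (by omega : 1 ≤ m)]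
    have hcost := Finset.sum_le_sum fun i (_ : i ∈ Finset.univ) => (hD v).1 i
    simp only [Finset.mem_univ, if_true, Finset.sum_const, Finset.card_univ, Fintype.card_fin,
      smul_eq_mul] at hcost
    calc ((∑ i, D.cost v i : ℕ) : ℝ) ≤ n * (Nat.clog 2 n * Nat.clog 2 (m + 1)) := by
          exact_mod_cast hcost
      _ ≤ n * ((2 * Real.logb 2 n) * (3 * Real.logb 2 m)) := by
          gcongr
      _ = 6 * (n * Real.logb 2 m * Real.logb 2 n) := by ring

end BinaryUpper

section TopItems

variable {n m : ℕ}

/-- `T` consists of `n` items of largest value for `v`. Each of them is worth the maximin share to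
a unit demand agent. -/
def IsTopSet (n : ℕ) (v : ItemValuation m) (T : Finset (Fin m)) : Prop :=
  T.card = n ∧ ∀ e ∈ T, ∀ e' ∉ T, v {e'} ≤ v {e}

theorem exists_isTopSet (hm : n ≤ m) (v : ItemValuation m) : ∃ T, IsTopSet n v T := by
  obtain ⟨T, -, hT, h⟩ := exists_top_subset Finset.univ (fun e : Fin m => v {e})
    (k := n) (by simpa using hm)
  exact ⟨T, hT, fun e he e' he' => h e he e' (by simpa using he')⟩

theorem IsTopSet.mms_le [NeZero n] {v : ItemValuation m} {T S : Finset (Fin m)} {e : Fin m}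
    (hT : IsTopSet n v T) (hv : IsUnitDemand v) (heT : e ∈ T) (heS : e ∈ S) : mms n v ≤ v S := by
  have hle : v {e} ≤ v S := by
    rw [hv.2.2 S ⟨e, heS⟩]
    exact Finset.le_sup' (fun e => v {e}) heS
  refine (_root_.mms_le fun P => ?_).trans hle
  obtain ⟨j, -, hj⟩ : ∃ j ∈ Finset.univ, j ∉ (T.erase e).image P := by
    refine Finset.exists_mem_notMem_of_card_lt_card (Finset.card_image_le.trans_lt ?_)
    rw [Finset.card_univ, Fintype.card_fin, ← hT.1]
    exact Finset.card_erase_lt_of_mem heT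
  refine ⟨j, ?_⟩
  rcases (bundle P j).eq_empty_or_nonempty with hempty | hne
  · rw [hempty, hv.2.1]
    exact hv.1 e
  · rw [hv.2.2 _ hne]
    refine Finset.sup'_le _ _ fun e' he' => ?_
    by_cases hee : e' = e
    · rw [hee]
    · exact hT.2 e heT e' fun he'T => hj <| Finset.mem_image.2
        ⟨e', Finset.mem_erase.2 ⟨hee, he'T⟩, mem_bundle.1 he'⟩

end TopItems

section Hashing

variable {α β κ : Type*}

-- Reed–Solomon codes: `α` is embedded into the polynomials of degree `< k` over `𝔽_{2^L}`, which
-- are hashed by evaluation.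
theorem exists_hash_family [Finite α] {L k : ℕ} (hL : L ≠ 0) (hα : Nat.card α ≤ (2 ^ L) ^ k) :
    ∃ hash : Fin (2 ^ L) → α → Fin (2 ^ L), ∀ e e', e ≠ e' →
      (Finset.univ.filter fun x => hash x e = hash x e').card ≤ k := by
  classical
  let F := GaloisField 2 L
  have hF : Nat.card F = 2 ^ L := GaloisField.card 2 L hL
  have : Finite F := Nat.finite_of_card_ne_zero (by rw [hF]; positivity)
  have : Fintype F := Fintype.ofFinite F
  have := Fintype.ofFinite α
  let num : F ≃ Fin (2 ^ L) := Finite.equivFinOfCardEq hF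
  obtain ⟨code⟩ : Nonempty (α ↪ (Fin k → F)) := Function.Embedding.nonempty_of_card_le (by
    rwa [← Nat.card_eq_fintype_card, ← Nat.card_eq_fintype_card, Nat.card_fun, hF, Nat.card_fin])
  let p : α → Polynomial.degreeLT F k := fun e => (Polynomial.degreeLTEquiv F k).symm (code e)
  have hp : Function.Injective p := (Polynomial.degreeLTEquiv F k).symm.injective.comp
    code.injective
  refine ⟨fun x e => num ((p e).1.eval (num.symm x)), fun e e' hne => ?_⟩
  have hq : (p e).1 - (p e').1 ≠ 0 := sub_ne_zero.2 fun h => hne (hp (Subtype.ext h))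
  have hdeg : ((p e).1 - (p e').1).natDegree < k := by
    rw [Polynomial.natDegree_lt_iff_degree_lt hq, ← Polynomial.mem_degreeLT]
    exact sub_mem (p e).2 (p e').2
  calc (Finset.univ.filter fun x => num ((p e).1.eval (num.symm x)) =
        num ((p e').1.eval (num.symm x))).card
      ≤ ((p e).1 - (p e').1).roots.toFinset.card := by
        refine Finset.card_le_card_of_injOn num.symm (fun x hx => ?_) num.symm.injective.injOn
        simpa [hq, sub_eq_zero] using hx
    _ ≤ k := (Multiset.toFinset_card_le _).trans ((Polynomial.card_roots' _).trans hdeg.le)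

/-- The indices for which a hash function is not injective on `T`. -/
noncomputable def collisions [Fintype κ] (hash : κ → α → β) (T : Finset α) : Finset κ := by
  classical exact Finset.univ.filter fun x => ¬ Set.InjOn (hash x) T

theorem injOn_of_notMem_collisions [Fintype κ] {hash : κ → α → β} {T : Finset α} {x : κ}
    (hx : x ∉ collisions hash T) : Set.InjOn (hash x) T := by
  simpa [collisions] using hx

theorem card_collisions_le [Fintype κ] [DecidableEq β] {hash : κ → α → β} {k : ℕ}
    (h : ∀ e e', e ≠ e' → (Finset.univ.filter fun x => hash x e = hash x e').card ≤ k)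
    (T : Finset α) : (collisions hash T).card ≤ T.card ^ 2 * k := by
  classical
  calc (collisions hash T).card
      ≤ (T.offDiag.biUnion fun p => Finset.univ.filter fun x => hash x p.1 = hash x p.2).card := by
        refine Finset.card_le_card fun x hx => ?_
        have hx : ¬ Set.InjOn (hash x) T := by simpa [collisions] using hx
        simp only [Set.InjOn] at hx
        push Not at hx
        obtain ⟨e, he, e', he', heq, hne⟩ := hx
        exact Finset.mem_biUnion.2
          ⟨(e, e'), Finset.mem_offDiag.2 ⟨he, he', hne⟩, by simpa using heq⟩
    _ ≤ T.offDiag.card * k := Finset.card_biUnion_le_card_mul _ _ k fun p hp =>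
        h p.1 p.2 (Finset.mem_offDiag.1 hp).2.2
    _ ≤ T.card ^ 2 * k := by
        rw [Finset.offDiag_card, sq]
        exact Nat.mul_le_mul_right _ (Nat.sub_le _ _)

end Hashing

section Selection

variable {ι X κ : Type*} [Fintype ι] [Nonempty ι] [DecidableEq ι]

-- Every agent reports her part of the sum in multiples of `W / (8 n)`, rounded down; the rounding
-- errors add up to at most `W / 8`.
theorem exists_estimate_dialogue {b : X → ℝ} (hb : ∀ u, 0 ≤ b u) {W : ℝ} (hW : 0 < W) :
    ∃ D : Dialogue ι X Bool, ∀ v, ∑ i, b (v i) ≤ W →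
      ∑ i, D.cost v i ≤ 9 * Fintype.card ι ∧
        (D.run v = true → ∑ i, b (v i) ≤ W * (5 / 8)) ∧
        (D.run v = false → W / 2 ≤ ∑ i, b (v i)) := by
  obtain ⟨n, hn⟩ : ∃ n, n = Fintype.card ι := ⟨_, rfl⟩
  have hn0 : (0 : ℝ) < n := by exact_mod_cast hn ▸ Fintype.card_pos
  let q : X → ℕ := fun u => ⌊8 * n * b u / W⌋₊
  obtain ⟨R, hR⟩ := Dialogue.exists_gather
    (fun i : ι => Dialogue.sendUnary i (8 * n) q) Finset.univ
  refine ⟨R.bind fun g => .done (decide (∑ i, g i ≤ 4 * n)), fun v hv => ?_⟩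
  have hlower : ((∑ i, q (v i) : ℕ) : ℝ) * W ≤ 8 * n * ∑ i, b (v i) := by
    rw [← le_div_iff₀ hW, Nat.cast_sum, Finset.mul_sum, Finset.sum_div]
    exact Finset.sum_le_sum fun i _ => Nat.floor_le (by have := hb (v i); positivity)
  have hupper : 8 * n * ∑ i, b (v i) ≤ ((∑ i, q (v i) : ℕ) + n : ℝ) * W := by
    rw [← div_le_iff₀ hW, Nat.cast_sum, Finset.mul_sum, Finset.sum_div]
    calc ∑ i, 8 * n * b (v i) / W ≤ ∑ i, ((q (v i) : ℝ) + 1) :=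
          Finset.sum_le_sum fun i _ => (Nat.lt_floor_add_one _).le
      _ = ∑ i, (q (v i) : ℝ) + n := by simp [Finset.sum_add_distrib, hn]
  have hq : ∑ i, q (v i) ≤ 8 * n := by
    have hmul : ((∑ i, q (v i) : ℕ) : ℝ) * W ≤ (8 * n) * W := hlower.trans (by gcongr)
    exact_mod_cast le_of_mul_le_mul_right hmul hW
  have hrun : ∑ i, R.run v i = ∑ i, q (v i) := Finset.sum_congr rfl fun i hi => by
    rw [(hR v).1 i hi, Dialogue.run_sendUnary]
    exact (Finset.single_le_sum (fun _ _ => Nat.zero_le _) hi).trans hq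
  simp only [Dialogue.run_bind, Dialogue.run_done, Dialogue.cost_bind, Dialogue.cost_done,
    add_zero, hrun, decide_eq_true_eq, decide_eq_false_iff_not, not_le]
  refine ⟨?_, fun hle => ?_, fun hlt => ?_⟩
  · calc ∑ i, R.cost v i ≤ ∑ i, (∑ j, Pi.single j (q (v j) + 1) : ι → ℕ) i := by
          rw [(hR v).2]
          exact Finset.sum_le_sum fun i _ => Finset.sum_le_sum
            (fun j _ => Dialogue.cost_sendUnary_le j (8 * n) q v) i
      _ = ∑ i, q (v i) + n := by simp [Finset.sum_add_distrib, hn]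
      _ ≤ 9 * Fintype.card ι := by omega
  · have hle : ((∑ i, q (v i) : ℕ) : ℝ) ≤ 4 * n := by exact_mod_cast hle
    refine le_of_mul_le_mul_left ?_ hn0
    nlinarith
  · have hlt : 4 * (n : ℝ) ≤ (∑ i, q (v i) : ℕ) := by exact_mod_cast hlt.le
    refine le_of_mul_le_mul_left ?_ hn0
    nlinarith

theorem exists_selection_dialogue [DecidableEq κ] (bad : X → Finset κ) (L : ℕ) (H : Finset κ)
    {W : ℝ} (hH : H.card = 2 ^ L) (hW : 0 < W) (hWL : W * (5 / 8) ^ L < 1) :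
    ∃ D : Dialogue ι X κ, ∀ v, ∑ i, ((bad (v i) ∩ H).card : ℝ) ≤ W →
      (∀ i, D.run v ∉ bad (v i)) ∧ ∑ i, D.cost v i ≤ 9 * Fintype.card ι * L := by
  induction L generalizing H W with
  | zero =>
    obtain ⟨x, rfl⟩ := Finset.card_eq_one.1 (by simpa using hH)
    refine ⟨.done x, fun v hv => ⟨fun i (hi : x ∈ bad (v i)) => ?_, by simp⟩⟩
    have hcard : ((bad (v i) ∩ {x}).card : ℝ) ≤ W :=
      (Finset.single_le_sum (f := fun i => ((bad (v i) ∩ {x}).card : ℝ))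
        (fun _ _ => Nat.cast_nonneg _) (Finset.mem_univ i)).trans hv
    rw [Finset.inter_eq_right.2 (Finset.singleton_subset_iff.2 hi), Finset.card_singleton] at hcard
    rw [pow_zero, mul_one] at hWL
    exact absurd hWL (by simpa using hcard)
  | succ L ih =>
    rw [pow_succ] at hH
    obtain ⟨H₀, hH₀, hH₀c⟩ := Finset.exists_subset_card_eq (s := H) (n := 2 ^ L) (by omega)
    have hW' : W * (5 / 8) * (5 / 8) ^ L < 1 := by rwa [mul_assoc, ← pow_succ']
    obtain ⟨D₀, hD₀⟩ := ih H₀ hH₀c (by positivity) hW'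
    obtain ⟨D₁, hD₁⟩ := ih (H \ H₀) (by rw [Finset.card_sdiff_of_subset hH₀]; omega)
      (by positivity) hW'
    obtain ⟨D, hD⟩ := exists_estimate_dialogue (ι := ι) (b := fun u => ((bad u ∩ H₀).card : ℝ))
      (fun u => Nat.cast_nonneg _) hW
    refine ⟨D.bind fun b => if b then D₀ else D₁, fun v hv => ?_⟩
    have hsplit : ∀ i, ((bad (v i) ∩ H).card : ℝ) =
        (bad (v i) ∩ H₀).card + (bad (v i) ∩ (H \ H₀)).card := fun i => by
      rw [← Nat.cast_add, ← Finset.card_union_of_disjoint, ← Finset.inter_union_distrib_left,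
        Finset.union_sdiff_of_subset hH₀]
      exact Finset.disjoint_sdiff.mono Finset.inter_subset_right Finset.inter_subset_right
    simp only [hsplit, Finset.sum_add_distrib] at hv
    have hnonneg : 0 ≤ ∑ i, ((bad (v i) ∩ (H \ H₀)).card : ℝ) :=
      Finset.sum_nonneg fun _ _ => Nat.cast_nonneg _
    obtain ⟨hcost, htrue, hfalse⟩ := hD v (by linarith)
    simp only [Dialogue.run_bind, Dialogue.cost_bind, Pi.add_apply, Finset.sum_add_distrib,
      mul_add, mul_one]
    cases hrun : D.run v
    · obtain ⟨hgood, hcost'⟩ := hD₁ v (by linarith [hfalse hrun])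
      exact ⟨hgood, (add_le_add hcost hcost').trans_eq (add_comm _ _)⟩
    · obtain ⟨hgood, hcost'⟩ := hD₀ v (htrue hrun)
      exact ⟨hgood, (add_le_add hcost hcost').trans_eq (add_comm _ _)⟩

end Selection

section UnitDemandUpper

variable {n m : ℕ}

theorem card_finset_card_le_one {β : Type*} [Finite β] :
    Nat.card {S : Finset β // S.card ≤ 1} ≤ Nat.card β + 1 := by
  rw [← Finite.card_option]
  refine Nat.card_le_card_of_surjective
    (fun b : Option β => (⟨b.toFinset, by cases b <;> simp⟩ : {S : Finset β // S.card ≤ 1})) ?_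
  rintro ⟨S, hS⟩
  obtain rfl | ⟨b, rfl⟩ : S = ∅ ∨ ∃ b, S = {b} := by
    rwa [Nat.le_one_iff_eq_zero_or_eq_one, Finset.card_eq_zero, Finset.card_eq_one] at hS
  exacts [⟨none, rfl⟩, ⟨some b, rfl⟩]

-- One after the other, the agents pick a free hash value of one of their items.
theorem exists_matching_dialogue [NeZero n] {X α β : Type*} [Finite β] {L : ℕ}
    (hL : Nat.card β + 1 ≤ 2 ^ L) (hash : α → β) (T : X → Finset α) :
    ∃ t : Dialogue (Fin n) X (α → Fin n), ∀ v, t.cost v = (fun _ => L) ∧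
      ((∀ i, n ≤ (T (v i)).card ∧ Set.InjOn hash (T (v i))) →
        ∀ i, ∃ e ∈ T (v i), t.run v e = i) := by
  classical
  obtain ⟨D, hD⟩ := exists_picking_dialogue (card_finset_card_le_one.trans hL)
    (fun u => (T u).image hash) (id : Fin n → Fin n) (x := fun _ => 1) fun _ => le_rfl
  refine ⟨D.bind fun g => .done fun e => if h : ∃ i, hash e ∈ g i then h.choose else 0,
    fun v => ⟨?_, fun hv i => ?_⟩⟩
  · simp [(hD v).1, Finset.univ_sum_single]
  have hg := (hD v).2 fun i => by
    rw [id, Finset.card_image_of_injOn (hv i).2]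
    simpa using (Nat.succ_le_of_lt i.isLt).trans (hv i).1
  simp only [Dialogue.run_bind, Dialogue.run_done]
  obtain ⟨b, hb⟩ : (D.run v i).Nonempty := by
    rw [← Finset.card_pos, (hg i).2.1]; exact one_pos
  obtain ⟨e, he, rfl⟩ := Finset.mem_image.1 ((hg i).1 hb)
  have hpicked : ∃ j, hash e ∈ D.run v j := ⟨i, hb⟩
  refine ⟨e, he, (dif_pos hpicked).trans ?_⟩
  by_contra hne
  rcases lt_or_gt_of_ne hne with hlt | hlt
  · exact Finset.disjoint_left.1 ((hg _).2.2 _ hlt) hb hpicked.choose_spec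
  · exact Finset.disjoint_left.1 ((hg _).2.2 _ hlt) hpicked.choose_spec hb

-- The agents agree on a hash function that is injective on the `n` best items of each of them, and
-- then allocate hash values instead of items.
theorem exists_unitDemand_dialogue [NeZero n] (hm : n ≤ m) {L k : ℕ} (hL : L ≠ 0) (hk : k ≠ 0)
    (hmk : m ≤ 2 ^ k) (hW : (n ^ 3 * k : ℝ) * (5 / 8) ^ L < 1) :
    ∃ t : Dialogue (Fin n) (ItemValuation m) (Allocation n m),
      ∀ v ∈ instances n (IsUnitDemand (m := m)), IsMMSAllocation v (t.run v) ∧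
        ∑ i, t.cost v i ≤ 9 * n * L + n * (L + 1) := by
  obtain ⟨hash, hhash⟩ := exists_hash_family (α := Fin m) (k := k) hL <| by
    rw [Nat.card_fin]
    exact hmk.trans (Nat.pow_le_pow_left (Nat.le_self_pow hL 2) k)
  choose T hT using exists_isTopSet hm
  have hn0 : (0 : ℝ) < n := by exact_mod_cast NeZero.pos n
  have hk0 : (0 : ℝ) < k := by exact_mod_cast Nat.pos_of_ne_zero hk
  obtain ⟨D, hD⟩ := exists_selection_dialogue (ι := Fin n)
    (fun u => collisions hash (T u)) L Finset.univ (by simp) (mul_pos (pow_pos hn0 3) hk0) hW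
  choose t ht using fun x => exists_matching_dialogue (n := n) (L := L + 1)
    (by rw [Nat.card_fin, pow_succ]; have := Nat.one_le_two_pow (n := L); omega) (hash x) T
  refine ⟨D.bind t, fun v hv => ?_⟩
  obtain ⟨hgood, hcost⟩ := hD v <| by
    calc ∑ i, ((collisions hash (T (v i)) ∩ Finset.univ).card : ℝ)
        ≤ ∑ _i : Fin n, (n ^ 2 * k : ℝ) := Finset.sum_le_sum fun i _ => by
          rw [Finset.inter_univ]
          exact_mod_cast (hT (v i)).1 ▸ card_collisions_le hhash (T (v i))
      _ = n ^ 3 * k := by simp; ring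
  simp only [Dialogue.run_bind, Dialogue.cost_bind, Pi.add_apply, Finset.sum_add_distrib,
    (ht _ v).1]
  refine ⟨fun i => ?_, by simpa [mul_add] using hcost⟩
  obtain ⟨e, he, hei⟩ := (ht (D.run v) v).2
    (fun i => ⟨(hT (v i)).1.ge, injOn_of_notMem_collisions (hgood i)⟩) i
  exact (hT (v i)).mms_le (hv i) he (mem_bundle.2 hei)

theorem logb_clog_le (hm : 2 ≤ m) :
    Real.logb 2 (Nat.clog 2 m) ≤ 1 + Real.logb 2 (Real.logb 2 m) := by
  have hlog : 1 ≤ Real.logb 2 (m : ℝ) := one_le_logb_two (by exact_mod_cast hm)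
  have hclog : 0 < Nat.clog 2 m := Nat.clog_pos one_lt_two hm
  rw [← Real.logb_self_eq_one one_lt_two, ← Real.logb_mul two_ne_zero (by positivity)]
  refine Real.logb_le_logb_of_le one_lt_two (by exact_mod_cast hclog) ?_
  linarith [clog_two_le (by omega : 1 ≤ m)]

theorem logb_logb_le {x y : ℝ} (hx : 2 ≤ x) (hy : 2 ≤ y) :
    Real.logb 2 (Real.logb 2 (x * y)) ≤ 1 + Real.logb 2 x + Real.logb 2 (Real.logb 2 y) := by
  have hx1 := one_le_logb_two hx
  have hy1 := one_le_logb_two hy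
  calc Real.logb 2 (Real.logb 2 (x * y))
      ≤ Real.logb 2 (2 * (Real.logb 2 x * Real.logb 2 y)) := by
        rw [Real.logb_mul (by positivity) (by positivity)]
        exact Real.logb_le_logb_of_le one_lt_two (by linarith) (by nlinarith)
    _ = 1 + Real.logb 2 (Real.logb 2 x) + Real.logb 2 (Real.logb 2 y) := by
        rw [Real.logb_mul two_ne_zero (by positivity),
          Real.logb_mul (by positivity) (by positivity), Real.logb_self_eq_one one_lt_two,
          add_assoc]
    _ ≤ 1 + Real.logb 2 x + Real.logb 2 (Real.logb 2 y) := by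
        linarith [logb_two_le_self (x := Real.logb 2 x) (by linarith)]

theorem exists_hash_length (hn : 2 ≤ n) (hm : 2 * n ≤ m) :
    ∃ L : ℕ, L ≠ 0 ∧ (n ^ 3 * Nat.clog 2 m : ℝ) * (5 / 8) ^ L < 1 ∧
      (L : ℝ) ≤ 12 + 12 * Real.logb 2 n + 3 * Real.logb 2 (Real.logb 2 (m / n)) := by
  have hn2 : (2 : ℝ) ≤ n := by exact_mod_cast hn
  have hmn : 2 ≤ (m : ℝ) / n := by
    rw [le_div_iff₀ (by linarith)]; exact_mod_cast hm
  have hk : 0 < Nat.clog 2 m := Nat.clog_pos one_lt_two (by omega)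
  have hN : 0 < n ^ 3 * Nat.clog 2 m := by positivity
  obtain ⟨j, hj⟩ : ∃ j, j = Nat.clog 2 (n ^ 3 * Nat.clog 2 m) + 1 := ⟨_, rfl⟩
  have hNj : n ^ 3 * Nat.clog 2 m < 2 ^ j := by
    rw [hj, pow_succ 2]
    have := Nat.le_pow_clog one_lt_two (n ^ 3 * Nat.clog 2 m)
    omega
  refine ⟨3 * j, by omega, ?_, ?_⟩
  · calc (n ^ 3 * Nat.clog 2 m : ℝ) * (5 / 8) ^ (3 * j)
        ≤ (n ^ 3 * Nat.clog 2 m) * (1 / 2) ^ j := by rw [pow_mul]; gcongr; norm_num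
      _ < 2 ^ j * (1 / 2) ^ j := by gcongr; exact_mod_cast hNj
      _ = 1 := by rw [← mul_pow]; norm_num
  · have hclog := clog_two_le hN
    have hsplit := logb_logb_le hn2 hmn
    rw [mul_div_cancel₀ _ (by positivity)] at hsplit
    push_cast at hclog
    rw [Real.logb_mul (by positivity) (by positivity), Real.logb_pow] at hclog
    push_cast [hj] at hclog ⊢
    linarith [logb_clog_le (by omega : 2 ≤ m)]

theorem unitDemand_upper : ∃ c : ℝ, 0 < c ∧ ∀ n m : ℕ, 1 ≤ n → 2 * n ≤ m →
    CCAtMost (instances n (IsUnitDemand (m := m)))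
      (c * (n * (Real.logb 2 n + Real.logb 2 (Real.logb 2 ((m : ℝ) / n))))) := by
  refine ⟨300, by norm_num, fun n m hn hm => ?_⟩
  have : NeZero n := ⟨by omega⟩
  have hn0 : (0 : ℝ) < n := by exact_mod_cast hn
  have hmn : 2 ≤ (m : ℝ) / n := by rw [le_div_iff₀ hn0]; exact_mod_cast hm
  have hloglog : 0 ≤ Real.logb 2 (Real.logb 2 ((m : ℝ) / n)) :=
    Real.logb_nonneg one_lt_two (one_le_logb_two hmn)
  rcases hn.eq_or_lt with rfl | hn2
  · exact CCAtMost.one_agent _ (by simpa using hloglog)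
  have hlog : 1 ≤ Real.logb 2 (n : ℝ) := one_le_logb_two (by exact_mod_cast hn2)
  obtain ⟨L, hL, hW, hLle⟩ := exists_hash_length hn2 hm
  obtain ⟨D, hD⟩ := exists_unitDemand_dialogue (by omega) hL
    (Nat.clog_pos one_lt_two (by omega)).ne' (Nat.le_pow_clog one_lt_two m) hW
  refine CCAtMost.of_dialogue D (fun v hv => (hD v hv).1) fun v hv => ?_
  calc ((∑ i, D.cost v i : ℕ) : ℝ) ≤ ((9 * n * L + n * (L + 1) : ℕ) : ℝ) := by
        exact_mod_cast (hD v hv).2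
    _ = n * (10 * L + 1) := by push_cast; ring
    _ ≤ n * (300 * (Real.logb 2 n + Real.logb 2 (Real.logb 2 ((m : ℝ) / n)))) := by
        gcongr; linarith
    _ = _ := by ring

end UnitDemandUpper

section IdenticalUnitDemandUpper

variable {n m : ℕ}

section Covering

variable {X Y : Type*} [Fintype Y] [Nonempty Y] {good : X → Y → Prop}
  [∀ x y, Decidable (good x y)] {Q : ℕ}

theorem exists_card_le_mul_card_filter
    (h : ∀ x, Fintype.card Y ≤ Q * (Finset.univ.filter fun y => good x y).card) (R : Finset X) :
    ∃ y, R.card ≤ Q * (R.filter fun x => good x y).card := by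
  obtain ⟨y, -, hy⟩ := Finset.exists_le_of_sum_le (s := Finset.univ)
    (f := fun _ : Y => R.card) (g := fun y => Q * (R.filter fun x => good x y).card)
    Finset.univ_nonempty <| by
      calc ∑ _y : Y, R.card = ∑ _x ∈ R, Fintype.card Y := by simp [mul_comm]
        _ ≤ ∑ x ∈ R, Q * (Finset.univ.filter fun y => good x y).card :=
          Finset.sum_le_sum fun x _ => h x
        _ = ∑ y, Q * (R.filter fun x => good x y).card := by
          simp only [Finset.card_filter, ← Finset.mul_sum]
          rw [Finset.sum_comm]
  exact ⟨y, hy⟩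

-- Some `y` is good for a fraction `1 / Q` of `R`; the rest of `R` is treated in the same way.
theorem exists_cover
    (h : ∀ x, Fintype.card Y ≤ Q * (Finset.univ.filter fun y => good x y).card) (N : ℕ)
    (R : Finset X) (hR : R.card * (1 - 1 / Q : ℝ) ^ N < 1) :
    ∃ C : Finset Y, C.card ≤ N ∧ ∀ x ∈ R, ∃ y ∈ C, good x y := by
  classical
  induction N generalizing R with
  | zero =>
    have hempty : R.card < 1 := by exact_mod_cast (by simpa using hR : (R.card : ℝ) < 1)
    exact ⟨∅, le_rfl, by simp [Finset.card_eq_zero.1 (Nat.lt_one_iff.1 hempty)]⟩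
  | succ N ih =>
    obtain ⟨y, hy⟩ := exists_card_le_mul_card_filter h R
    have hgood : (R.card : ℝ) / Q ≤ (R.filter fun x => good x y).card :=
      div_le_of_le_mul₀ Q.cast_nonneg (Nat.cast_nonneg _) (by rw [mul_comm]; exact_mod_cast hy)
    have hrest : ((R.filter fun x => ¬ good x y).card : ℝ) ≤ R.card * (1 - 1 / Q) := by
      have hsum : ((R.filter fun x => good x y).card : ℝ)
          + (R.filter fun x => ¬ good x y).card = R.card := by
        exact_mod_cast Finset.card_filter_add_card_filter_not (s := R) fun x => good x y
      rw [mul_one_sub, mul_one_div]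
      linarith
    have hQ : 0 ≤ (1 - 1 / Q : ℝ) := Nat.one_sub_one_div_cast_nonneg Q
    obtain ⟨C, hC, hcover⟩ := ih (R.filter fun x => ¬ good x y) <| by
      refine lt_of_le_of_lt ?_ hR
      rw [pow_succ', ← mul_assoc]
      gcongr
    refine ⟨insert y C, (Finset.card_insert_le _ _).trans (by omega), fun x hx => ?_⟩
    by_cases hg : good x y
    · exact ⟨y, Finset.mem_insert_self _ _, hg⟩
    · obtain ⟨y', hy', hxy'⟩ := hcover x (Finset.mem_filter.2 ⟨hx, hg⟩)
      exact ⟨y', Finset.mem_insert_of_mem hy', hxy'⟩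

end Covering

theorem pow_self_le_four_pow_mul_factorial (n : ℕ) : n ^ n ≤ 4 ^ n * n.factorial := by
  have hexp : (n : ℝ) ^ n ≤ Real.exp n * n.factorial :=
    (div_le_iff₀ (by positivity)).1 (Real.pow_div_factorial_le_exp _ n.cast_nonneg n)
  have hfour : Real.exp n ≤ 4 ^ n := by
    rw [← Real.exp_one_pow]
    gcongr
    linarith [Real.exp_one_lt_three]
  have hmul : (n : ℝ) ^ n ≤ 4 ^ n * n.factorial := hexp.trans (by gcongr)
  exact_mod_cast hmul

theorem factorial_mul_pow_le_card_splitting {K : Finset (Fin m)} (hK : K.card = n) :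
    n.factorial * n ^ (m - n) ≤ (Finset.univ.filter fun A : Allocation n m =>
      ∀ i, (K ∩ bundle A i).card = 1).card := by
  let f : (K ≃ Fin n) × ({e // e ∉ K} → Fin n) → Allocation n m :=
    (Equiv.piEquivPiSubtypeProd (· ∈ K) fun _ => Fin n).symm ∘ Prod.map (⇑) id
  have hf : Function.Injective f :=
    (Equiv.injective _).comp (DFunLike.coe_injective.prodMap Function.injective_id)
  have hsplit : ∀ p i, (K ∩ bundle (f p) i).card = 1 := fun p =>
    card_inter_bundle_eq_of_le (by rw [hK, mul_one]) fun i => Finset.card_pos.2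
      ⟨(p.1.symm i).1, by simp [f, Equiv.piEquivPiSubtypeProd]⟩
  calc n.factorial * n ^ (m - n)
      = (Finset.univ : Finset ((K ≃ Fin n) × ({e // e ∉ K} → Fin n))).card := by
        simp [Fintype.card_equiv (K.equivFinOfCardEq hK), Fintype.card_subtype_compl, hK]
    _ ≤ _ := Finset.card_le_card_of_injOn f (fun p _ => by simpa using hsplit p) hf.injOn

theorem card_allocation_le_mul_card_splitting {K : Finset (Fin m)} (hK : K.card = n) :
    Fintype.card (Allocation n m) ≤ 4 ^ n * (Finset.univ.filter fun A : Allocation n m =>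
      ∀ i, (K ∩ bundle A i).card = 1).card := by
  have hnm : n ≤ m := by rw [← hK]; simpa using Finset.card_le_univ K
  calc Fintype.card (Allocation n m) = n ^ n * n ^ (m - n) := by
        rw [pow_mul_pow_sub _ hnm]; simp
    _ ≤ 4 ^ n * n.factorial * n ^ (m - n) := by
        gcongr; exact pow_self_le_four_pow_mul_factorial n
    _ ≤ _ := by rw [mul_assoc]; gcongr; exact factorial_mul_pow_le_card_splitting hK

theorem two_pow_mul_one_sub_div_pow_lt_one {Q : ℕ} (hQ : 1 ≤ Q) (j : ℕ) :
    (2 : ℝ) ^ j * (1 - 1 / Q) ^ (Q * (j + 1)) < 1 := by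
  have hQ' : (1 : ℝ) ≤ Q := by exact_mod_cast hQ
  have hhalf : (1 - 1 / Q : ℝ) ^ Q ≤ 1 / 2 :=
    (Real.one_sub_div_pow_le_exp_neg hQ').trans (by linarith [Real.exp_neg_one_lt_d9])
  have hnonneg : 0 ≤ (1 - 1 / Q : ℝ) := Nat.one_sub_one_div_cast_nonneg Q
  calc (2 : ℝ) ^ j * (1 - 1 / Q) ^ (Q * (j + 1)) ≤ 2 ^ j * (1 / 2) ^ (j + 1) := by
        rw [pow_mul]; gcongr
    _ = 1 / 2 := by rw [pow_succ, ← mul_assoc, ← mul_pow]; norm_num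
    _ < 1 := by norm_num

theorem exists_perfect_hash_family [NeZero n] {k : ℕ} (hk : m ≤ 2 ^ k) :
    ∃ F : Finset (Allocation n m), F.card ≤ 4 ^ n * (n * k + 1) ∧ SplitsEvenly F 1 := by
  obtain ⟨F, hF, hcover⟩ := exists_cover (X := {K : Finset (Fin m) // K.card = n})
    (good := fun K (A : Allocation n m) => ∀ i, (K.1 ∩ bundle A i).card = 1)
    (fun K => card_allocation_le_mul_card_splitting K.2) (4 ^ n * (n * k + 1)) Finset.univ <| by
      refine lt_of_le_of_lt ?_
        (two_pow_mul_one_sub_div_pow_lt_one (Nat.one_le_pow n 4 (by norm_num)) (n * k))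
      have hcard : (Finset.univ : Finset {K : Finset (Fin m) // K.card = n}).card
          ≤ 2 ^ (n * k) := by
        rw [Finset.card_univ, Fintype.card_finset_len, Fintype.card_fin, mul_comm, pow_mul]
        exact (Nat.choose_le_pow m n).trans (Nat.pow_le_pow_left hk n)
      have hnonneg : 0 ≤ (1 - 1 / (4 ^ n : ℕ) : ℝ) := Nat.one_sub_one_div_cast_nonneg _
      gcongr
      exact_mod_cast hcard
  refine ⟨F, hF, fun K hK => ?_⟩
  simpa using hcover ⟨K, by simpa using hK⟩ (Finset.mem_univ _)

theorem exists_identical_unitDemand_dialogue [NeZero n] (hm : n ≤ m)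
    {F : Finset (Allocation n m)} (hF : SplitsEvenly F 1) {L : ℕ} (hL : F.card ≤ 2 ^ L) :
    ∃ t : Dialogue (Fin n) (ItemValuation m) (Allocation n m),
      ∀ v ∈ identicalInstances n (IsUnitDemand (m := m)),
        IsMMSAllocation v (t.run v) ∧ ∑ i, t.cost v i = L := by
  choose T hT using exists_isTopSet hm
  choose A hAF hA using fun u => hF (T u) (by rw [(hT u).1, mul_one])
  have : Nonempty F := ⟨⟨A fun _ => 0, hAF _⟩⟩
  obtain ⟨t, ht⟩ := Dialogue.exists_send (0 : Fin n) (α := F) (by simpa using hL)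
    fun u => ⟨A u, hAF u⟩
  refine ⟨t.bind fun B => .done B.1, ?_⟩
  rintro v ⟨u, hu, hv⟩
  refine ⟨fun i => ?_, by simp [(ht v).2]⟩
  simp only [Dialogue.run_bind, (ht v).1, Dialogue.run_done, hv]
  obtain ⟨e, he⟩ := Finset.card_pos.1 (hA u i ▸ one_pos)
  exact (hT u).mms_le hu (Finset.mem_inter.1 he).1 (Finset.mem_inter.1 he).2

theorem identical_unitDemand_upper : ∃ c : ℝ, 0 < c ∧ ∀ n m : ℕ, 1 ≤ n → 2 * n ≤ m →
    CCAtMost (identicalInstances n (IsUnitDemand (m := m)))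
      (c * (n + Real.logb 2 (Real.logb 2 m))) := by
  refine ⟨9, by norm_num, fun n m hn hm => ?_⟩
  have : NeZero n := ⟨by omega⟩
  obtain ⟨F, hFcard, hF⟩ := exists_perfect_hash_family (n := n) (Nat.le_pow_clog one_lt_two m)
  have hFN := hFcard.trans (Nat.le_pow_clog one_lt_two _)
  obtain ⟨t, ht⟩ := exists_identical_unitDemand_dialogue (by omega) hF hFN
  refine CCAtMost.of_dialogue t (fun v hv => (ht v hv).1) fun v hv => ?_
  rw [(ht v hv).2]
  have hn1 : (1 : ℝ) ≤ n := by exact_mod_cast hn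
  have hloglog : 0 ≤ Real.logb 2 (Real.logb 2 (m : ℝ)) := Real.logb_nonneg one_lt_two
    (one_le_logb_two (by exact_mod_cast (by omega : 2 ≤ m)))
  have hk : 0 < Nat.clog 2 m := Nat.clog_pos one_lt_two (by omega)
  have hk1 : (1 : ℝ) ≤ Nat.clog 2 m := by exact_mod_cast hk
  have hN : Real.logb 2 ((4 ^ n * (n * Nat.clog 2 m + 1) : ℕ) : ℝ)
      ≤ 2 * n + (1 + (Real.logb 2 n + Real.logb 2 (Nat.clog 2 m))) := by
    calc _ ≤ Real.logb 2 ((2 ^ 2) ^ n * (2 * (n * Nat.clog 2 m))) := by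
          refine Real.logb_le_logb_of_le one_lt_two (by positivity) ?_
          push_cast
          have : (1 : ℝ) ≤ n * Nat.clog 2 m := one_le_mul_of_one_le_of_one_le hn1 hk1
          norm_num
          linarith
      _ = _ := by
          rw [← pow_mul, Real.logb_mul (by positivity) (by positivity),
            Real.logb_mul (by positivity) (by positivity),
            Real.logb_mul (by positivity) (by positivity), Real.logb_pow,
            Real.logb_self_eq_one one_lt_two]
          push_cast
          ring
  linarith [clog_two_le (Nat.mul_pos (by positivity : 0 < 4 ^ n) (n * Nat.clog 2 m).succ_pos),
    logb_clog_le (by omega : 2 ≤ m), logb_two_le_self (x := n) (by positivity)]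

end IdenticalUnitDemandUpper

theorem theorem2 :
    -- unit demand valuations
    (∃ c : ℝ, 0 < c ∧ ∀ n m : ℕ, 1 ≤ n → 2 * n ≤ m →
      CCAtMost (instances n (IsUnitDemand (m := m)))
        (c * (n * (Real.logb 2 n + Real.logb 2 (Real.logb 2 ((m : ℝ) / n)))))) ∧
    -- binary additive valuations
    (∃ c : ℝ, 0 < c ∧ ∀ n m : ℕ, 1 ≤ n → 2 * n ≤ m →
      CCAtMost (instances n (IsBinary (m := m)))
        (c * (n * Real.logb 2 m * Real.logb 2 n))) ∧
    -- 2-valued additive valuations, in total and for each agent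
    (∃ c : ℝ, 0 < c ∧ ∀ n m : ℕ, 1 ≤ n → 2 * n ≤ m → ∀ a b : ℝ, 0 ≤ b → b < a →
      ∃ P : Protocol n m, P.SolvesMMS (instances n (IsTwoValued a b)) ∧
        ∀ v ∈ instances n (IsTwoValued (m := m) a b),
          (P.bits v : ℝ) ≤ c * (m * Real.logb 2 n) ∧
          ∀ i, (P.agentBits v i : ℝ) ≤ c * ((m : ℝ) / n * Real.logb 2 n)) ∧
    -- identical unit demand valuations
    (∃ c : ℝ, 0 < c ∧ ∀ n m : ℕ, 1 ≤ n → 2 * n ≤ m →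
      CCAtMost (identicalInstances n (IsUnitDemand (m := m)))
        (c * (n + Real.logb 2 (Real.logb 2 m)))) ∧
    (∃ c : ℝ, 0 < c ∧ ∀ n m : ℕ, 2 ≤ n → 2 * n ≤ m →
      CCAtLeast (identicalInstances n (IsUnitDemand (m := m)))
        (c * (n + Real.logb 2 (Real.logb 2 m)))) ∧
    -- identical binary additive valuations
    (∃ c : ℝ, 0 < c ∧ ∀ n m : ℕ, 2 ≤ n → 2 * n ≤ m →
      CCAtLeast (identicalInstances n (IsBinary (m := m)))
        (c * (n * Real.logb 2 ((m : ℝ) / n)))) ∧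
    -- identical 2-valued additive valuations
    (∃ c : ℝ, 0 < c ∧ ∀ n m : ℕ, 1 ≤ n → 2 * n ≤ m → ∀ a b : ℝ, 0 ≤ b → b < a →
      CCAtMost (identicalInstances n (IsTwoValued (m := m) a b)) (c * m)) ∧
    (∃ c : ℝ, 0 < c ∧ ∀ n m : ℕ, 2 ≤ n → 2 * n ≤ m → ∃ a b : ℝ, 0 ≤ b ∧ b < a ∧
      CCAtLeast (identicalInstances n (IsTwoValued (m := m) a b)) (c * m)) :=
  ⟨unitDemand_upper, binary_upper, twoValued_upper, identical_unitDemand_upper,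
    identical_unitDemand_lower, identical_binary_lower, identical_twoValued_upper,
    identical_twoValued_lower⟩
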